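/- **Setting.** An *isometric embedding* is a distance-preserving map. An *extended metric* may take the value $\infty$. $d_H$ is the Hausdorff distance between subsets of a metric space (with $d_H(\emptyset,\emptyset)=0$ and $d_H(\emptyset,A)=\infty$ for $A\ne\emptyset$). A metric space is *boundedly compact* if all its closed balls are compact; $\overline B_r(o)$ is the closed ball. (a) Let $\tau$ be a functor from the category of compact metric spaces (including the empty one), with isometric embeddings as morphisms, to the category whose objects are extended metric spaces $A$ with a partial order such that $\{a'\in A: a'\le a\}$ is compact for every $a\in A$, and whose morphisms are the order-preserving isometric embeddings. So $f:X\to Y$ gives $\tau_f:\tau(X)\to\tau(Y)$. Assume that if $f:X\to X$ is an isometry of $X$ onto itself, $a\in\tau(X)$ and $\tau_f(a)\le a$, then $\tau_f(a)=a$. (b) Let $\tau^t$ be a contravariant functor from compact metric spaces to posets with $\tau^t(X)=\tau(X)$ as posets, so that $f:X\to Y$ gives an order-preserving $\tau^t_f:\tau(Y)\to\tau(X)$, such that $\tau^t_f(\tau_f(a))=a$ and $\tau_f(\tau^t_f(b))\le b$ for all $f:X\to Y$, $a\in\tau(X)$, $b\in\tau(Y)$. (c) For a boundedly-compact $X$,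 let $\varphi(X)$ be the set of families $a=(a_K)_K$, indexed by the compact subsets $K$ of $X$, with $a_K\in\tau(K)$ and $\tau^t_\iota(a_L)=a_K$ whenever $\iota:K\hookrightarrow L$ is an inclusion of compact subsets. Let $\mathcal C'$ be the set of isomorphism classes of tuples $\mathcal X=(X,o;a)$ with $X$ boundedly compact, $o\in X$, $a\in\varphi(X)$; an isomorphism $(X,o;a)\to(X',o';a')$ is a surjective isometric embedding $e:X\to X'$ with $e(o)=o'$ and $\tau_{e|_K}(a_K)=a'_{e(K)}$ for all compact $K\subseteq X$. If $X$ is compact, $a\in\tau(X)$ is identified with the family $(\tau^t_{K\hookrightarrow X}(a))_K\in\varphi(X)$. (d) For tuples $(X,o_X;a)$, $(Y,o_Y;b)$ with $X,Y$ compact, $a\in\tau(X)$, $b\in\tau(Y)$, let $$d^c\big((X,o_X;a),(Y,o_Y;b)\big)=\inf_{Z,f,g}\ \max\{d_H(f(X),g(Y)),\ d(f(o_X),g(o_Y)),\ d(\tau_f(a),\tau_g(b))\},$$ the infimum being over all compact metric spaces $Z$ and isometric embeddings $f:X\to Z$, $g:Y\to Z$. (e) For a tuple $\mathcal X=(X,o;a)$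 and $r\ge 0$, let $\mathcal X^{(r)}=(\overline B_r(o),o;a_{\overline B_r(o)})$. For a compact $K\subseteq X$ containing $o$ and $a'\in\tau(K)$, write $(K,o;a')\preceq\mathcal X$ if $a'\le a_K$; in particular, for such tuples on compact subsets $K\subseteq L$, $(K,o;a')\preceq(L,o;a'')$ means $a'\le\tau^t_{K\hookrightarrow L}(a'')$. For $0<\epsilon\le 1$ let $$a_\epsilon(\mathcal X,\mathcal Y)=\inf\{d^c(\mathcal X^{(1/\epsilon)},\mathcal Y')\ :\ \mathcal Y^{(1/\epsilon-\epsilon)}\preceq\mathcal Y'\preceq\mathcal Y\},$$ where $\mathcal Y'$ has a compact underlying space, and define the distance on $\mathcal C'$ by $$d(\mathcal X,\mathcal Y)=\inf\{\epsilon\in(0,1]:\ \max(a_\epsilon(\mathcal X,\mathcal Y),a_\epsilon(\mathcal Y,\mathcal X))<\epsilon/2\},\qquad \inf\emptyset:=1 .$$ **Assumptions.** 1. For all tuples $\mathcal X,\mathcal Y$ with compact underlying spaces and every $\mathcal X'\preceq\mathcal X$ there is $\mathcal Y'\preceq\mathcal Y$ with $d^c(\mathcal X',\mathcal Y')\le d^c(\mathcal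 X,\mathcal Y)$. 2. If moreover $\epsilon:=d^c(\mathcal X,\mathcal Y)<\infty$, $r\ge 2\epsilon$ and $\mathcal X^{(r)}\preceq\mathcal X'\preceq\mathcal X$, then $\mathcal Y'$ in 1 can be chosen with $\mathcal Y^{(r-2\epsilon)}\preceq\mathcal Y'\preceq\mathcal Y$. 3. If $Z,X,X_1,X_2,\dots$ are compact metric spaces, $f:X\to Z$ and $f_n:X_n\to Z$ are isometric embeddings with $d_H(f_n(X_n),f(X))\to0$, and $a_n\in\tau(X_n)$, $b\in\tau(Z)$ satisfy $\tau_{f_n}(a_n)\to b$, then $b\in\operatorname{Im}(\tau_f)$. 4. $\tau$ is pointwise-continuous: if isometric embeddings $f_n:X\to Y$ of compact metric spaces converge pointwise to an isometric embedding $f$, then $\tau_{f_n}\to\tau_f$ pointwise. 5. $\tau$ is Hausdorff-continuous: in the situation of 3 (without $a_n$, $b$), $d_H(\operatorname{Im}\tau_{f_n},\operatorname{Im}\tau_f)\to0$. **Theorem.** Under these assumptions: (i) if $\tau(X)$ is complete for every compact metric space $X$, then $(\mathcal C',d)$ is complete, i.e. every $d$-Cauchy sequence in $\mathcal C'$ converges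 with respect to $d$; (ii) if $\tau(X)$ is separable for every compact metric space $X$, then $(\mathcal C',d)$ is separable, i.e. $\mathcal C'$ has a countable subset that is dense with respect to $d$. -/

import Mathlib

open scoped NNReal ENNReal
open Filter Topology TopologicalSpace

universe u v

namespace GHF

/-- A functor from the category of compact metric spaces (morphisms: isometric embeddings) to the
category of extended metric spaces (morphisms: isometric embeddings). -/
structure MetricFunctor where
  obj : (X : Type u) → [MetricSpace X] → [CompactSpace X] → Type v
  [emetric : ∀ (X : Type u) [MetricSpace X] [CompactSpace X], EMetricSpace (obj X)]
  map : ∀ {X Y : Type u} [MetricSpace X] [CompactSpace X] [MetricSpace Y] [CompactSpace Y]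
    (f : X → Y), Isometry f → obj X → obj Y
  isometry_map : ∀ {X Y : Type u} [MetricSpace X] [CompactSpace X] [MetricSpace Y]
    [CompactSpace Y] (f : X → Y) (hf : Isometry f), Isometry (map f hf)
  map_id : ∀ {X : Type u} [MetricSpace X] [CompactSpace X] (a : obj X),
    map (id : X → X) isometry_id a = a
  map_comp : ∀ {X Y Z : Type u} [MetricSpace X] [CompactSpace X] [MetricSpace Y] [CompactSpace Y]
    [MetricSpace Z] [CompactSpace Z] (f : X → Y) (hf : Isometry f) (g : Y → Z) (hg : Isometry g)
    (a : obj X), map (g ∘ f) (hg.comp hf) a = map g hg (map f hf a)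

attribute [instance] MetricFunctor.emetric

namespace MetricFunctor

variable (τ : MetricFunctor.{u, v})

/-- If `f n → f` pointwise, then `τ (f n) → τ f` pointwise. -/
def PointwiseContinuous : Prop :=
  ∀ (X Y : Type u) [MetricSpace X] [CompactSpace X] [MetricSpace Y] [CompactSpace Y]
    (f : X → Y) (hf : Isometry f) (fn : ℕ → X → Y) (hfn : ∀ n, Isometry (fn n)),
    (∀ x, Tendsto (fun n => fn n x) atTop (𝓝 (f x))) →
    ∀ a : τ.obj X, Tendsto (fun n => τ.map (fn n) (hfn n) a) atTop (𝓝 (τ.map f hf a))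

/-- If `Im (f n) → Im f` in the Hausdorff distance, then `Im (τ (f n)) → Im (τ f)` in the
Hausdorff distance. -/
def HausdorffContinuous : Prop :=
  ∀ (Z X : Type u) [MetricSpace Z] [CompactSpace Z] [MetricSpace X] [CompactSpace X]
    (Xn : ℕ → Type u) [∀ n, MetricSpace (Xn n)] [∀ n, CompactSpace (Xn n)]
    (f : X → Z) (hf : Isometry f) (fn : ∀ n, Xn n → Z) (hfn : ∀ n, Isometry (fn n)),
    Tendsto (fun n => Metric.hausdorffEDist (Set.range (fn n)) (Set.range f)) atTop (𝓝 0) →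
    Tendsto (fun n => Metric.hausdorffEDist (Set.range (τ.map (fn n) (hfn n)))
      (Set.range (τ.map f hf))) atTop (𝓝 0)

/-- If `Im (f n) → Im f` in the Hausdorff distance and `τ (f n) (a n) → b`, then
`b ∈ Im (τ f)`. -/
def ImageClosed : Prop :=
  ∀ (Z X : Type u) [MetricSpace Z] [CompactSpace Z] [MetricSpace X] [CompactSpace X]
    (Xn : ℕ → Type u) [∀ n, MetricSpace (Xn n)] [∀ n, CompactSpace (Xn n)]
    (f : X → Z) (hf : Isometry f) (fn : ∀ n, Xn n → Z) (hfn : ∀ n, Isometry (fn n)),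
    Tendsto (fun n => Metric.hausdorffEDist (Set.range (fn n)) (Set.range f)) atTop (𝓝 0) →
    ∀ (b : τ.obj Z) (a : ∀ n, τ.obj (Xn n)),
      Tendsto (fun n => τ.map (fn n) (hfn n) (a n)) atTop (𝓝 b) → b ∈ Set.range (τ.map f hf)

/-- The Gromov-Hausdorff-functor distance between `(X, a)` and `(Y, b)`: the infimum, over all
compact metric spaces `Z` and isometric embeddings `f : X → Z`, `g : Y → Z`, of
`d_H (f X, g Y) ∨ d (τ f a, τ g b)`. -/
noncomputable def ghf {X Y : Type u} [MetricSpace X] [CompactSpace X] [MetricSpace Y]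
    [CompactSpace Y] (a : τ.obj X) (b : τ.obj Y) : ℝ≥0∞ :=
  ⨅ (Z : Type u) (_ : MetricSpace Z) (_ : CompactSpace Z) (f : X → Z) (hf : Isometry f)
    (g : Y → Z) (hg : Isometry g),
    max (Metric.hausdorffEDist (Set.range f) (Set.range g)) (edist (τ.map f hf a) (τ.map g hg b))

/-- The functor `X ↦ X × τ X`, with the max product metric. -/
def pointed : MetricFunctor.{u, max u v} where
  obj X _ _ := X × τ.obj X
  emetric X _ _ := Prod.emetricSpaceMax
  map f hf := Prod.map f (τ.map f hf)
  isometry_map f hf := hf.prodMap (τ.isometry_map f hf)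
  map_id a := by simp [Prod.map, τ.map_id]
  map_comp f hf g hg a := by simp [Prod.map, τ.map_comp f hf g hg]

end MetricFunctor

/-- A functor from compact metric spaces to the category of extended metric spaces carrying a
partial order with compact cones `{a' | a' ≤ a}`; the morphisms of the latter category are the
order-preserving isometric embeddings. -/
structure PosFunctor extends MetricFunctor.{u, v} where
  [order : ∀ (X : Type u) [MetricSpace X] [CompactSpace X], PartialOrder (obj X)]
  isCompact_cone : ∀ {X : Type u} [MetricSpace X] [CompactSpace X] (a : obj X),
    IsCompact {a' : obj X | a' ≤ a}
  monotone_map : ∀ {X Y : Type u} [MetricSpace X] [CompactSpace X] [MetricSpace Y]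
    [CompactSpace Y] (f : X → Y) (hf : Isometry f), Monotone (map f hf)

attribute [instance] PosFunctor.order

/-- For every isometry `f` of a compact space onto itself, `τ f a ≤ a` only if `τ f a = a`. -/
def PosFunctor.NoShrinking (τ : PosFunctor.{u, v}) : Prop :=
  ∀ (X : Type u) [MetricSpace X] [CompactSpace X] (f : X ≃ᵢ X) (a : τ.obj X),
    τ.map f f.isometry a ≤ a → τ.map f f.isometry a = a

/-- A truncation functor for `τ`: a contravariant functor to posets with the same objects. -/
structure Truncation (τ : PosFunctor.{u, v}) where
  trunc : ∀ {X Y : Type u} [MetricSpace X] [CompactSpace X] [MetricSpace Y] [CompactSpace Y]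
    (f : X → Y), Isometry f → τ.obj Y → τ.obj X
  monotone_trunc : ∀ {X Y : Type u} [MetricSpace X] [CompactSpace X] [MetricSpace Y]
    [CompactSpace Y] (f : X → Y) (hf : Isometry f), Monotone (trunc f hf)
  trunc_id : ∀ {X : Type u} [MetricSpace X] [CompactSpace X] (a : τ.obj X),
    trunc (id : X → X) isometry_id a = a
  trunc_comp : ∀ {X Y Z : Type u} [MetricSpace X] [CompactSpace X] [MetricSpace Y]
    [CompactSpace Y] [MetricSpace Z] [CompactSpace Z] (f : X → Y) (hf : Isometry f) (g : Y → Z)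
    (hg : Isometry g) (c : τ.obj Z), trunc (g ∘ f) (hg.comp hf) c = trunc f hf (trunc g hg c)
  trunc_map : ∀ {X Y : Type u} [MetricSpace X] [CompactSpace X] [MetricSpace Y] [CompactSpace Y]
    (f : X → Y) (hf : Isometry f) (a : τ.obj X), trunc f hf (τ.map f hf a) = a
  map_trunc_le : ∀ {X Y : Type u} [MetricSpace X] [CompactSpace X] [MetricSpace Y]
    [CompactSpace Y] (f : X → Y) (hf : Isometry f) (b : τ.obj Y), τ.map f hf (trunc f hf b) ≤ b

/-- The inclusion map of compact subsets `K ⊆ L`. -/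
def incl {X : Type u} [MetricSpace X] {K L : Compacts X} (h : K ≤ L) : K → L :=
  fun x => ⟨x.1, h x.2⟩

theorem isometry_incl {X : Type u} [MetricSpace X] {K L : Compacts X} (h : K ≤ L) :
    Isometry (incl h) := fun _ _ => rfl

/-- The restriction `K → K'` of an isometry `e` with `e(K) = K'`. -/
def restr {X Y : Type u} [MetricSpace X] [MetricSpace Y] (e : X ≃ᵢ Y) {K : Compacts X}
    {K' : Compacts Y} (h : (K' : Set Y) = e '' K) : K → K' :=
  fun x => ⟨e x.1, by
    rw [← SetLike.mem_coe, h]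
    exact Set.mem_image_of_mem e x.2⟩

theorem isometry_restr {X Y : Type u} [MetricSpace X] [MetricSpace Y] (e : X ≃ᵢ Y)
    {K : Compacts X} {K' : Compacts Y} (h : (K' : Set Y) = e '' K) : Isometry (restr e h) :=
  fun x y => e.isometry x.1 y.1

/-- The compact closed ball of radius `r` in a boundedly-compact space. -/
def cball {X : Type u} [MetricSpace X] [ProperSpace X] (o : X) (r : ℝ≥0) : Compacts X :=
  ⟨Metric.closedBall o r, isCompact_closedBall o r⟩

theorem mem_cball_self {X : Type u} [MetricSpace X] [ProperSpace X] (o : X) (r : ℝ≥0) :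
    o ∈ cball o r := Metric.mem_closedBall_self r.2

section Spaces

variable {τ : PosFunctor.{u, v}} (T : Truncation τ)

/-- The extension `φ(X)` of `τ` to boundedly-compact `X`: families `a_K ∈ τ(K)`, indexed by the
compact subsets `K` of `X`, that are compatible with truncation. -/
structure Phi (X : Type u) [MetricSpace X] where
  val : ∀ K : Compacts X, τ.obj K
  compat : ∀ (K L : Compacts X) (h : K ≤ L), T.trunc (incl h) (isometry_incl h) (val L) = val K

/-- A pointed boundedly-compact metric space with an additional structure, `(X, o; a)` with
`a ∈ φ(X)`. -/
structure Tuple where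
  carrier : Type u
  [metric : MetricSpace carrier]
  [proper : ProperSpace carrier]
  origin : carrier
  str : Phi T carrier

attribute [instance] Tuple.metric Tuple.proper

/-- A pointed compact metric space with an additional structure, `(X, o; a)` with `a ∈ τ(X)`. -/
structure CompactTuple (τ : PosFunctor.{u, v}) where
  carrier : Type u
  [metric : MetricSpace carrier]
  [compact : CompactSpace carrier]
  origin : carrier
  str : τ.obj carrier

attribute [instance] CompactTuple.metric CompactTuple.compact

/-- The distance `d^c_{τ'}`, where `τ'(X) = X × τ(X)`. -/
noncomputable def dc (A B : CompactTuple τ) : ℝ≥0∞ :=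
  (MetricFunctor.pointed τ.toMetricFunctor).ghf (X := A.carrier) (Y := B.carrier)
    (A.origin, A.str) (B.origin, B.str)

/-- A compact tuple, regarded as a boundedly-compact one: `a ∈ τ(X)` is identified with the family
of its truncations to the compact subsets of `X`. -/
def CompactTuple.toTuple (A : CompactTuple τ) : Tuple T where
  carrier := A.carrier
  origin := A.origin
  str :=
    { val := fun K => T.trunc (Subtype.val : K → A.carrier) isometry_subtype_coe A.str
      compat := fun K L h =>
        (T.trunc_comp (incl h) (isometry_incl h) (Subtype.val : L → A.carrier)
          isometry_subtype_coe A.str).symm }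

variable {T}

/-- A tuple `(K, o; a)` where `K` is a compact subset of `𝒳` containing the origin of `𝒳`, which is
also the origin of `K`, and `a ∈ τ(K)` is arbitrary. -/
structure Piece (𝒳 : Tuple T) where
  carrier : Compacts 𝒳.carrier
  origin_mem : 𝒳.origin ∈ carrier
  str : τ.obj carrier

def Piece.toCompactTuple {𝒳 : Tuple T} (P : Piece 𝒳) : CompactTuple τ where
  carrier := P.carrier
  origin := ⟨𝒳.origin, P.origin_mem⟩
  str := P.str

/-- `P ≼ 𝒳`: the structure of `P` is below the truncation of that of `𝒳`. -/
def Piece.Below {𝒳 : Tuple T} (P : Piece 𝒳) : Prop := P.str ≤ 𝒳.str.val P.carrier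

/-- `P ≼ Q`, for two tuples on compact subsets of the same space. -/
def Piece.Le {𝒳 : Tuple T} (P Q : Piece 𝒳) : Prop :=
  ∃ h : P.carrier ≤ Q.carrier, P.str ≤ T.trunc (incl h) (isometry_incl h) Q.str

/-- The closed ball of radius `r` about the origin, with the truncation of the structure. -/
def Tuple.ball (𝒳 : Tuple T) (r : ℝ≥0) : Piece 𝒳 where
  carrier := cball 𝒳.origin r
  origin_mem := mem_cball_self 𝒳.origin r
  str := 𝒳.str.val (cball 𝒳.origin r)

/-- `a_ε(𝒳, 𝒴)`, the infimum of `d^c(𝒳^(1/ε), 𝒴')` over the compact tuples `𝒴'` with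
`𝒴^(1/ε - ε) ≼ 𝒴' ≼ 𝒴` (used for `0 < ε ≤ 1`, where `1/ε - ε ≥ 0`). -/
noncomputable def aFun (ε : ℝ≥0) (𝒳 𝒴 : Tuple T) : ℝ≥0∞ :=
  ⨅ (P : Piece 𝒴) (_ : (𝒴.ball (ε⁻¹ - ε)).Le P) (_ : P.Below),
    dc (𝒳.ball ε⁻¹).toCompactTuple P.toCompactTuple

/-- The infimum of the `ε ∈ (0, 1]` with `a_ε(𝒳, 𝒴) ∨ a_ε(𝒴, 𝒳) < ε / 2`, and `1` if there are
none (inserting `1` changes nothing otherwise). -/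
noncomputable def Tuple.dist (𝒳 𝒴 : Tuple T) : ℝ≥0 :=
  sInf (insert 1 {ε : ℝ≥0 | 0 < ε ∧ ε ≤ 1 ∧ max (aFun ε 𝒳 𝒴) (aFun ε 𝒴 𝒳) < (ε : ℝ≥0∞) / 2})

/-- `e` is an isomorphism of tuples: an isometry of the spaces that maps the origin to the origin
and transports the one structure to the other. -/
def Tuple.IsIso (𝒳 𝒴 : Tuple T) (e : 𝒳.carrier ≃ᵢ 𝒴.carrier) : Prop :=
  e 𝒳.origin = 𝒴.origin ∧
    ∀ (K : Compacts 𝒳.carrier) (K' : Compacts 𝒴.carrier) (h : (K' : Set 𝒴.carrier) = e '' K),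
      τ.map (restr e h) (isometry_restr e h) (𝒳.str.val K) = 𝒴.str.val K'

theorem map_congr {X Y : Type u} [MetricSpace X] [CompactSpace X] [MetricSpace Y] [CompactSpace Y]
    {f g : X → Y} (hf : Isometry f) (hg : Isometry g) (h : f = g) (a : τ.obj X) :
    τ.map f hf a = τ.map g hg a := by
  subst h; rfl

theorem map_map_eq_self {X Y : Type u} [MetricSpace X] [CompactSpace X] [MetricSpace Y]
    [CompactSpace Y] {f : X → Y} {g : Y → X} (hf : Isometry f) (hg : Isometry g)
    (h : ∀ x, g (f x) = x) (a : τ.obj X) : τ.map g hg (τ.map f hf a) = a := by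
  rw [← τ.map_comp, map_congr (hg.comp hf) isometry_id (funext h), τ.map_id]

theorem trunc_congr (T : Truncation τ) {X Y : Type u} [MetricSpace X] [CompactSpace X]
    [MetricSpace Y] [CompactSpace Y] {f g : X → Y} (hf : Isometry f) (hg : Isometry g) (h : f = g)
    (a : τ.obj Y) : T.trunc f hf a = T.trunc g hg a := by
  subst h; rfl

theorem map_eq_trunc (T : Truncation τ) {X Y : Type u} [MetricSpace X] [CompactSpace X]
    [MetricSpace Y] [CompactSpace Y] {f : X → Y} {g : Y → X} (hf : Isometry f) (hg : Isometry g)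
    (h : ∀ x, g (f x) = x) (a : τ.obj X) : τ.map f hf a = T.trunc g hg a := by
  conv_rhs => rw [← map_map_eq_self hf hg h a]
  rw [T.trunc_map]

theorem image_symm {X Y : Type u} [MetricSpace X] [MetricSpace Y] (e : X ≃ᵢ Y) {K : Compacts X}
    {K' : Compacts Y} (h : (K' : Set Y) = e '' K) : (K : Set X) = e.symm '' K' := by
  rw [h, Set.image_image]; simp

theorem restr_symm_restr {X Y : Type u} [MetricSpace X] [MetricSpace Y] (e : X ≃ᵢ Y)
    {K : Compacts X} {K' : Compacts Y} (h : (K' : Set Y) = e '' K)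
    (h' : (K : Set X) = e.symm '' K') (x : K) : restr e.symm h' (restr e h x) = x :=
  Subtype.ext (e.symm_apply_apply x.1)

theorem restr_restr_symm {X Y : Type u} [MetricSpace X] [MetricSpace Y] (e : X ≃ᵢ Y)
    {K : Compacts X} {K' : Compacts Y} (h : (K' : Set Y) = e '' K)
    (h' : (K : Set X) = e.symm '' K') (x : K') : restr e h (restr e.symm h' x) = x :=
  Subtype.ext (e.apply_symm_apply x.1)

/-- Truncation commutes with the restrictions of an isometry. -/
theorem trunc_map_restr (T : Truncation τ) {X Y : Type u} [MetricSpace X] [MetricSpace Y]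
    (e : X ≃ᵢ Y) {K L : Compacts X} {K' L' : Compacts Y} (hK : (K' : Set Y) = e '' K)
    (hL : (L' : Set Y) = e '' L) (h : K ≤ L) (h' : K' ≤ L') (a : τ.obj L) :
    T.trunc (incl h') (isometry_incl h') (τ.map (restr e hL) (isometry_restr e hL) a) =
      τ.map (restr e hK) (isometry_restr e hK) (T.trunc (incl h) (isometry_incl h) a) := by
  rw [map_eq_trunc T (isometry_restr e hL) (isometry_restr e.symm (image_symm e hL))
      (restr_symm_restr e hL (image_symm e hL)),
    map_eq_trunc T (isometry_restr e hK) (isometry_restr e.symm (image_symm e hK))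
      (restr_symm_restr e hK (image_symm e hK)), ← T.trunc_comp, ← T.trunc_comp]
  exact trunc_congr T _ _ rfl a

theorem Tuple.IsIso.symm {𝒳 𝒴 : Tuple T} {e : 𝒳.carrier ≃ᵢ 𝒴.carrier} (he : 𝒳.IsIso 𝒴 e) :
    𝒴.IsIso 𝒳 e.symm := by
  refine ⟨by rw [← he.1, e.symm_apply_apply], fun K K' h => ?_⟩
  have h' : (K : Set 𝒴.carrier) = e '' K' := by simpa using image_symm e.symm h
  rw [← he.2 K' K h']
  exact map_map_eq_self _ _ (restr_symm_restr e h' h) _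

theorem Tuple.isIso_refl (𝒳 : Tuple T) : 𝒳.IsIso 𝒳 (IsometryEquiv.refl _) := by
  refine ⟨rfl, fun K K' h => ?_⟩
  obtain rfl : K' = K := SetLike.coe_injective (h.trans (Set.image_id _))
  exact (map_congr _ isometry_id rfl _).trans (τ.map_id _)

theorem Tuple.IsIso.trans {𝒳 𝒴 𝒵 : Tuple T} {e : 𝒳.carrier ≃ᵢ 𝒴.carrier}
    {f : 𝒴.carrier ≃ᵢ 𝒵.carrier} (he : 𝒳.IsIso 𝒴 e) (hf : 𝒴.IsIso 𝒵 f) :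
    𝒳.IsIso 𝒵 (e.trans f) := by
  refine ⟨by simp [he.1, hf.1], fun K K' h => ?_⟩
  have h1 : ((K.map e e.continuous : Compacts 𝒴.carrier) : Set 𝒴.carrier) = e '' K := by simp
  have h2 : (K' : Set 𝒵.carrier) = f '' (K.map e e.continuous : Compacts 𝒴.carrier) := by
    rw [h1, h, Set.image_image]; rfl
  rw [← hf.2 _ _ h2, ← he.2 _ _ h1, ← τ.map_comp]
  exact map_congr _ _ rfl _

variable (T) in
/-- Isomorphism of tuples, as an equivalence relation. -/
def tupleSetoid : Setoid (Tuple T) where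
  r 𝒳 𝒴 := ∃ e, 𝒳.IsIso 𝒴 e
  iseqv :=
    { refl := fun 𝒳 => ⟨_, 𝒳.isIso_refl⟩
      symm := fun ⟨_, he⟩ => ⟨_, he.symm⟩
      trans := fun ⟨_, he⟩ ⟨_, hf⟩ => ⟨_, he.trans hf⟩ }

theorem dc_le_of_iso {A A' B B' : CompactTuple τ} (f : A.carrier → A'.carrier) (hf : Isometry f)
    (sf : Function.Surjective f) (of : f A.origin = A'.origin) (mf : τ.map f hf A.str = A'.str)
    (g : B.carrier → B'.carrier) (hg : Isometry g) (sg : Function.Surjective g)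
    (og : g B.origin = B'.origin) (mg : τ.map g hg B.str = B'.str) : dc A B ≤ dc A' B' := by
  unfold dc MetricFunctor.ghf
  refine le_iInf fun Z => le_iInf fun iM => le_iInf fun iC => le_iInf fun p => le_iInf fun hp =>
    le_iInf fun q => le_iInf fun hq => ?_
  refine iInf_le_of_le Z ?_
  refine iInf_le_of_le iM ?_
  refine iInf_le_of_le iC ?_
  refine iInf_le_of_le (p ∘ f) ?_
  refine iInf_le_of_le (hp.comp hf) ?_
  refine iInf_le_of_le (q ∘ g) ?_
  refine iInf_le_of_le (hq.comp hg) ?_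
  rw [sf.range_comp, sg.range_comp]
  have h1 : (MetricFunctor.pointed τ.toMetricFunctor).map (p ∘ f) (hp.comp hf)
      (A.origin, A.str) = (MetricFunctor.pointed τ.toMetricFunctor).map p hp (A'.origin, A'.str) :=
    Prod.ext (congrArg p of) ((τ.map_comp f hf p hp A.str).trans (congrArg _ mf))
  have h2 : (MetricFunctor.pointed τ.toMetricFunctor).map (q ∘ g) (hq.comp hg)
      (B.origin, B.str) = (MetricFunctor.pointed τ.toMetricFunctor).map q hq (B'.origin, B'.str) :=
    Prod.ext (congrArg q og) ((τ.map_comp g hg q hq B.str).trans (congrArg _ mg))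
  exact max_le_max le_rfl (le_of_eq (congrArg₂ edist h1 h2))

theorem cball_image {X Y : Type u} [MetricSpace X] [ProperSpace X] [MetricSpace Y] [ProperSpace Y]
    (e : X ≃ᵢ Y) {o : X} {o' : Y} (h : e o = o') (r : ℝ≥0) :
    (cball o' r : Set Y) = e '' (cball o r : Set X) := by
  subst h; exact (e.image_closedBall o r).symm

theorem restr_surjective {X Y : Type u} [MetricSpace X] [MetricSpace Y] (e : X ≃ᵢ Y)
    {K : Compacts X} {K' : Compacts Y} (h : (K' : Set Y) = e '' K) :
    Function.Surjective (restr e h) :=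
  fun y => ⟨_, restr_restr_symm e h (image_symm e h) y⟩

theorem aFun_le_of_iso {𝒳 𝒳' 𝒴 𝒴' : Tuple T} {i : 𝒳.carrier ≃ᵢ 𝒳'.carrier}
    {j : 𝒴.carrier ≃ᵢ 𝒴'.carrier} (hi : 𝒳.IsIso 𝒳' i) (hj : 𝒴.IsIso 𝒴' j) (ε : ℝ≥0) :
    aFun ε 𝒳 𝒴 ≤ aFun ε 𝒳' 𝒴' := by
  unfold aFun
  refine le_iInf fun P' => le_iInf fun h1 => le_iInf fun h2 => ?_
  obtain ⟨h1, h1'⟩ := h1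
  have hK : ((P'.carrier.map j.symm j.symm.continuous : Compacts 𝒴.carrier) : Set 𝒴.carrier) =
      j.symm '' P'.carrier := by simp
  have hK' : (P'.carrier : Set 𝒴'.carrier) =
      j '' (P'.carrier.map j.symm j.symm.continuous : Compacts 𝒴.carrier) := by
    simpa using image_symm j.symm hK
  let P : Piece 𝒴 :=
    { carrier := P'.carrier.map j.symm j.symm.continuous
      origin_mem := by
        rw [← SetLike.mem_coe, hK]
        exact ⟨_, P'.origin_mem, hj.symm.1⟩
      str := τ.map (restr j.symm hK) (isometry_restr j.symm hK) P'.str }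
  have hb := cball_image j.symm hj.symm.1 (ε⁻¹ - ε)
  have hle : (𝒴.ball (ε⁻¹ - ε)).carrier ≤ P.carrier := by
    rw [← SetLike.coe_subset_coe]
    change (cball 𝒴.origin (ε⁻¹ - ε) : Set 𝒴.carrier) ⊆
      (P'.carrier.map j.symm j.symm.continuous : Compacts 𝒴.carrier)
    rw [hb, hK]
    exact Set.image_mono h1
  refine iInf_le_of_le P <| iInf_le_of_le ⟨hle, ?_⟩ <| iInf_le_of_le ?_ ?_
  · change 𝒴.str.val (cball 𝒴.origin (ε⁻¹ - ε)) ≤ _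
    rw [← hj.symm.2 _ _ hb]
    refine (τ.monotone_map _ _ h1').trans (le_of_eq ?_)
    exact (trunc_map_restr T j.symm hb hK h1 hle P'.str).symm
  · change τ.map (restr j.symm hK) (isometry_restr j.symm hK) P'.str ≤ _
    rw [← hj.symm.2 _ _ hK]
    exact τ.monotone_map _ _ h2
  · have hc := cball_image i hi.1 ε⁻¹
    exact dc_le_of_iso (A := (𝒳.ball ε⁻¹).toCompactTuple) (A' := (𝒳'.ball ε⁻¹).toCompactTuple)
      (B := P.toCompactTuple) (B' := P'.toCompactTuple)
      (restr i hc) (isometry_restr i hc) (restr_surjective i hc) (Subtype.ext hi.1)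
      (hi.2 _ _ hc) (restr j hK') (isometry_restr j hK') (restr_surjective j hK')
      (Subtype.ext hj.1) (map_map_eq_self _ _ (restr_restr_symm j hK' hK) _)

theorem Tuple.dist_congr {𝒳 𝒳' 𝒴 𝒴' : Tuple T} (hX : ∃ e, 𝒳.IsIso 𝒳' e)
    (hY : ∃ e, 𝒴.IsIso 𝒴' e) : 𝒳.dist 𝒴 = 𝒳'.dist 𝒴' := by
  obtain ⟨i, hi⟩ := hX
  obtain ⟨j, hj⟩ := hY
  have h1 : ∀ ε, aFun ε 𝒳 𝒴 = aFun ε 𝒳' 𝒴' := fun ε =>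
    le_antisymm (aFun_le_of_iso hi hj ε) (aFun_le_of_iso hi.symm hj.symm ε)
  have h2 : ∀ ε, aFun ε 𝒴 𝒳 = aFun ε 𝒴' 𝒳' := fun ε =>
    le_antisymm (aFun_le_of_iso hj hi ε) (aFun_le_of_iso hj.symm hi.symm ε)
  simp only [Tuple.dist, h1, h2]

variable (T)

/-- The space `𝒞'` of isomorphism classes of tuples. -/
def CPrime : Type (max (u + 1) v) := Quotient (tupleSetoid T)

/-- The distance on `𝒞'`. -/
noncomputable def CPrime.dist (x y : CPrime T) : ℝ≥0 :=
  Quotient.liftOn₂ (s₁ := tupleSetoid T) (s₂ := tupleSetoid T) x y Tuple.dist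
    fun _ _ _ _ hX hY => Tuple.dist_congr hX hY

/-- For compact `𝒳`, `𝒴` and `𝒳' ≼ 𝒳` there is `𝒴' ≼ 𝒴` with
`d^c(𝒳', 𝒴') ≤ d^c(𝒳, 𝒴)`. -/
def Truncation.SubsetProperty : Prop :=
  ∀ (A B : CompactTuple τ) (P : Piece (A.toTuple T)), P.Below →
    ∃ Q : Piece (B.toTuple T), Q.Below ∧ dc P.toCompactTuple Q.toCompactTuple ≤ dc A B

/-- In the previous property, if moreover `𝒳^(r) ≼ 𝒳'` and `r ≥ 2 ε` with `ε = d^c(𝒳, 𝒴)`, then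
`𝒴'` can be chosen with `𝒴^(r - 2 ε) ≼ 𝒴'`. -/
def Truncation.BallSubsetProperty : Prop :=
  ∀ (A B : CompactTuple τ) (P : Piece (A.toTuple T)) (r ε : ℝ≥0), dc A B = ε → 2 * ε ≤ r →
    ((A.toTuple T).ball r).Le P → P.Below →
    ∃ Q : Piece (B.toTuple T), ((B.toTuple T).ball (r - 2 * ε)).Le Q ∧ Q.Below ∧
      dc P.toCompactTuple Q.toCompactTuple ≤ dc A B

end Spaces

/-- Every Cauchy sequence for the distance function `d` converges. -/
def CauchyComplete {C : Type*} (d : C → C → ℝ≥0) : Prop :=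
  ∀ x : ℕ → C, (∀ ε > 0, ∃ N, ∀ m ≥ N, ∀ n ≥ N, d (x m) (x n) < ε) →
    ∃ y, ∀ ε > 0, ∃ N, ∀ n ≥ N, d (x n) y < ε

/-- There is a countable set that is dense for the distance function `d`. -/
def CountablyDense {C : Type*} (d : C → C → ℝ≥0) : Prop :=
  ∃ S : Set C, S.Countable ∧ ∀ x, ∀ ε > 0, ∃ y ∈ S, d x y < ε

end GHF

/-!
A lower embedding `(K, o; b) → (X, o; a)` of tuples makes the first isomorphic to a tuple
`≼ (X, o; a)`. A tuple `A` embedded in this way contains the `r`-ball of `𝒴`, that is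
`𝒴^(r) ≼ A ≼ 𝒴`, exactly when lower embeddings into `𝒴` that stay in the `r`-ball factor through
`A`; this makes such sandwiches compose. Assumption 2 transports a sandwich along `d^c`-close
spaces at the cost of twice the distance in the radius, whence the triangle inequality.

For completeness, fix `k` and transport a sandwich of radius about `2k` along a fast Cauchy
sequence `Y n`. The radii lost are summable, and the resulting compact tuples are `d^c`-Cauchy.
Gluing all the couplings into one compact space, Hausdorff continuity and the completeness of the
values of `τ` provide a `d^c`-limit `B k`. By Arzelà–Ascoli and pointwise continuity the sandwich
relation passes to `d^c`-limits: since cones `{b ≤ a}` are compact, an isometric self-embedding of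
a compact tuple that does not increase the structure is invertible, so that the limiting maps do
not lose anything. Hence `B k` is the `2k`-ball of `B (k + 1)` up to sandwiching, and the inductive
limit of the `B k` is the limit of `Y n`.

For separability, every tuple is close to its balls, every compact space is close to a member of a
sequence that is dense in the Gromov–Hausdorff space, and Hausdorff continuity of `τ` moves the
structure on the former to one on the latter, where a countable dense set is available.
-/

namespace GHF

section Isometries

variable {X Y Z : Type*} [MetricSpace X] [MetricSpace Y] [MetricSpace Z]

theorem exists_isometry_lift {f : X → Z} (hf : Isometry f) {g : Y → Z} (hg : Isometry g)
    (h : ∀ y, g y ∈ Set.range f) : ∃ g' : Y → X, Isometry g' ∧ ∀ y, f (g' y) = g y := by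
  choose g' hg' using h
  exact ⟨g', fun x y => by rw [← hf.edist_eq, hg', hg', hg.edist_eq], hg'⟩

theorem isometry_iterate {f : X → X} (hf : Isometry f) (n : ℕ) : Isometry f^[n] := by
  induction n with
  | zero => exact isometry_id
  | succ n ih => exact ih.comp hf

theorem exists_subseq_tendsto_isometry [CompactSpace X] [CompactSpace Y] (f : ℕ → X → Y)
    (hf : ∀ n, Isometry (f n)) :
    ∃ (g : X → Y) (φ : ℕ → ℕ), Isometry g ∧ StrictMono φ ∧
      ∀ x, Tendsto (fun n => f (φ n) x) atTop (𝓝 (g x)) := by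
  let A : Set (BoundedContinuousFunction X Y) := {g | Isometry g}
  have eval_continuous (x : X) : Continuous fun g : BoundedContinuousFunction X Y => g x :=
    (BoundedContinuousFunction.lipschitz_eval_const x).continuous
  have closed : IsClosed A := by
    simp only [A, isometry_iff_dist_eq, Set.ofPred_forall]
    exact isClosed_iInter fun x => isClosed_iInter fun y =>
      isClosed_eq ((eval_continuous x).dist (eval_continuous y)) continuous_const
  have compact : IsCompact A := BoundedContinuousFunction.arzela_ascoli₁ A closed <|
    Metric.equicontinuous_of_continuity_modulus id tendsto_id _ fun x y g => (g.2.dist_eq x y).le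
  obtain ⟨g, hg, φ, hφ, hlim⟩ := compact.tendsto_subseq
    (x := fun n => BoundedContinuousFunction.mkOfCompact ⟨f n, (hf n).continuous⟩) hf
  exact ⟨g, φ, hg, hφ, fun x => ((eval_continuous x).tendsto g).comp hlim⟩

theorem exists_iterate_tendsto_id [CompactSpace X] {f : X → X} (hf : Isometry f) :
    ∃ φ : ℕ → ℕ, ∀ x, Tendsto (fun n => f^[φ n + 1] x) atTop (𝓝 x) := by
  obtain ⟨g, ψ, -, hψ, hg⟩ :=
    exists_subseq_tendsto_isometry (fun n => f^[n]) (isometry_iterate hf)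
  refine ⟨fun n => ψ (n + 1) - ψ n - 1, fun x => tendsto_iff_dist_tendsto_zero.2 ?_⟩
  have hdist (n : ℕ) :
      dist (f^[ψ (n + 1)] x) (f^[ψ n] x) = dist (f^[ψ (n + 1) - ψ n - 1 + 1] x) x := by
    have hlt : ψ n < ψ (n + 1) := hψ n.lt_succ_self
    rw [← (isometry_iterate hf (ψ n)).dist_eq _ x, ← Function.iterate_add_apply,
      show ψ n + (ψ (n + 1) - ψ n - 1 + 1) = ψ (n + 1) by omega]
  simpa [hdist] using ((hg x).comp (tendsto_add_atTop_nat 1)).dist (hg x)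

theorem surjective_of_isometry [CompactSpace X] {f : X → X} (hf : Isometry f) :
    Function.Surjective f := by
  intro x
  obtain ⟨φ, hφ⟩ := exists_iterate_tendsto_id hf
  refine (isCompact_range hf.continuous).isClosed.mem_of_tendsto (hφ x)
    (Eventually.of_forall fun n => ?_)
  rw [Function.iterate_succ_apply']
  exact Set.mem_range_self _

theorem mem_of_tendsto_of_tendsto_infEDist {X : Type*} [PseudoEMetricSpace X] {K : Set X}
    (hK : IsClosed K) {u : ℕ → X} {x : X} (hu : Tendsto u atTop (𝓝 x))
    (h : Tendsto (fun n => Metric.infEDist (u n) K) atTop (𝓝 0)) : x ∈ K :=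
  (Metric.mem_iff_infEDist_zero_of_closed hK).2 <|
    tendsto_nhds_unique ((Metric.continuous_infEDist.tendsto x).comp hu) h

theorem isCompact_iUnion_union_of_tendsto {X : Type*} [MetricSpace X]
    {K : ℕ → NonemptyCompacts X} {L : NonemptyCompacts X} (h : Tendsto K atTop (𝓝 L)) :
    IsCompact ((⋃ n, (K n : Set X)) ∪ L) := by
  have hK : Tendsto (fun n => (K n).toCompacts) atTop (𝓝 L.toCompacts) :=
    (NonemptyCompacts.continuous_toCompacts.tendsto L).comp h
  simpa [Set.union_comm] using
    Compacts.isCompact_biUnion_coe_of_isCompact hK.isCompact_insert_range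

end Isometries

section Gluing

theorem compactSpace_glueSpace {A X Y : Type*} [MetricSpace A] [Nonempty A] [MetricSpace X]
    [CompactSpace X] [MetricSpace Y] [CompactSpace Y] {f : A → X} (hf : Isometry f) {g : A → Y}
    (hg : Isometry g) : CompactSpace (Metric.GlueSpace hf hg) := by
  refine ⟨((isCompact_range (Metric.toGlueL_isometry hf hg).continuous).union
    (isCompact_range (Metric.toGlueR_isometry hf hg).continuous)).of_isClosed_subset
    isClosed_univ ?_⟩
  rintro ⟨x | y⟩ -
  · exact Or.inl ⟨x, rfl⟩
  · exact Or.inr ⟨y, rfl⟩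

/-- A metric space together with an isometric embedding of `W` into it, used to glue infinitely
many spaces by recursion. -/
structure Extension (W : Type u) [MetricSpace W] where
  space : Type u
  [metric : MetricSpace space]
  embed : W → space
  isometry_embed : Isometry embed

attribute [instance] Extension.metric

section Sequences

variable {A W : ℕ → Type u} [∀ n, MetricSpace (A n)] [∀ n, Nonempty (A n)]
  [∀ n, MetricSpace (W n)] {l : ∀ n, A n → W n} {r : ∀ n, A (n + 1) → W n}

/-- The result of gluing `W 0, …, W n` successively, `W k` and `W (k + 1)` along `A (k + 1)`, as an
extension of the last of them. -/
noncomputable def successiveGlue (hl : ∀ n, Isometry (l n)) (hr : ∀ n, Isometry (r n)) :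
    ∀ n, Extension (W n)
  | 0 => ⟨W 0, id, isometry_id⟩
  | n + 1 =>
    { space := Metric.GlueSpace ((successiveGlue hl hr n).isometry_embed.comp (hr n)) (hl (n + 1))
      embed := Metric.toGlueR _ _
      isometry_embed := Metric.toGlueR_isometry _ _ }

theorem exists_complete_glue (hl : ∀ n, Isometry (l n)) (hr : ∀ n, Isometry (r n)) :
    ∃ (Z : Type u) (_ : MetricSpace Z) (_ : CompleteSpace Z) (h : ∀ n, W n → Z),
      (∀ n, Isometry (h n)) ∧ ∀ n x, h n (r n x) = h (n + 1) (l (n + 1) x) := by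
  let Y := successiveGlue hl hr
  let e (n : ℕ) : (Y n).space → (Y (n + 1)).space :=
    Metric.toGlueL ((Y n).isometry_embed.comp (hr n)) (hl (n + 1))
  have he (n : ℕ) : Isometry (e n) := Metric.toGlueL_isometry _ _
  refine ⟨UniformSpace.Completion (Metric.InductiveLimit he), inferInstance, inferInstance,
    fun n x => ↑(Metric.toInductiveLimit he n ((Y n).embed x)), fun n => ?_, fun n x => ?_⟩
  · exact UniformSpace.Completion.coe_isometry.comp
      ((Metric.toInductiveLimit_isometry he n).comp (Y n).isometry_embed)
  · refine congrArg _ ?_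
    rw [← Metric.toInductiveLimit_commute he n]
    exact congrArg _
      (congrFun (Metric.toGlue_commute ((Y n).isometry_embed.comp (hr n)) (hl (n + 1))) x)

theorem exists_compact_glue [∀ n, CompactSpace (W n)] (hl : ∀ n, Isometry (l n))
    (hr : ∀ n, Isometry (r n))
    (hl' : ∀ n, Metric.hausdorffEDist (Set.range (l n)) Set.univ ≤ 2⁻¹ ^ n)
    (hr' : ∀ n, Metric.hausdorffEDist (Set.range (r n)) Set.univ ≤ 2⁻¹ ^ n) :
    ∃ (Z : Type u) (_ : MetricSpace Z) (_ : CompactSpace Z) (h : ∀ n, W n → Z),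
      (∀ n, Isometry (h n)) ∧ ∀ n x, h n (r n x) = h (n + 1) (l (n + 1) x) := by
  obtain ⟨Z, _, _, h, hh, hlr⟩ := exists_complete_glue hl hr
  have (n : ℕ) : Nonempty (W n) := Nonempty.map (l n) inferInstance
  let K (n : ℕ) : NonemptyCompacts Z :=
    ⟨⟨Set.range (h n), isCompact_range (hh n).continuous⟩, Set.range_nonempty (h n)⟩
  have hausdorffEDist_comp {B : Type u} (n : ℕ) (f : B → W n) :
      Metric.hausdorffEDist (Set.range (h n ∘ f)) (Set.range (h n)) =
        Metric.hausdorffEDist (Set.range f) Set.univ := by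
    rw [Set.range_comp, ← Set.image_univ (f := h n), Metric.hausdorffEDist_image (hh n)]
  have edist_le (n : ℕ) : edist (K n) (K (n + 1)) ≤ 2 * 2⁻¹ ^ n := by
    calc edist (K n) (K (n + 1))
      _ = Metric.hausdorffEDist (Set.range (h n)) (Set.range (h (n + 1))) := rfl
      _ ≤ _ := Metric.hausdorffEDist_triangle (t := Set.range (h n ∘ r n))
      _ ≤ 2⁻¹ ^ n + 2⁻¹ ^ (n + 1) := by
        rw [Metric.hausdorffEDist_comm, hausdorffEDist_comp, (funext (hlr n) : h n ∘ r n = _)]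
        exact add_le_add (hr' n) ((hausdorffEDist_comp _ _).trans_le (hl' (n + 1)))
      _ ≤ 2⁻¹ ^ n + 2⁻¹ ^ n := by
        gcongr _ + ?_
        exact pow_le_pow_right_of_le_one' (by simp) n.le_succ
      _ = 2 * 2⁻¹ ^ n := (two_mul _).symm
  obtain ⟨L, hL⟩ := cauchySeq_tendsto_of_complete <|
    cauchySeq_of_edist_le_geometric 2⁻¹ 2 (by simp) (by simp) edist_le
  have hcompact := isCompact_iUnion_union_of_tendsto hL
  exact ⟨↥((⋃ n, (K n : Set Z)) ∪ L), inferInstance, isCompact_iff_compactSpace.1 hcompact,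
    fun n w => ⟨h n w, Or.inl (Set.mem_iUnion.2 ⟨n, w, rfl⟩)⟩, fun n x y => hh n x y,
    fun n x => Subtype.ext (hlr n x)⟩

theorem exists_compact_star_glue {B : Type u} [MetricSpace B] [Nonempty B]
    [∀ n, CompactSpace (W n)] {j : ∀ n, B → W n} (hj : ∀ n, Isometry (j n))
    (hj' : ∀ n, Metric.hausdorffEDist (Set.range (j n)) Set.univ ≤ 2⁻¹ ^ n) :
    ∃ (Z : Type u) (_ : MetricSpace Z) (_ : CompactSpace Z) (g : B → Z) (h : ∀ n, W n → Z),
      Isometry g ∧ (∀ n, Isometry (h n)) ∧ ∀ n x, h n (j n x) = g x := by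
  obtain ⟨Z, _, _, h, hh, hcomm⟩ :=
    exists_compact_glue (A := fun _ => B) (l := j) (r := j) hj hj hj' hj'
  refine ⟨Z, ‹_›, ‹_›, h 0 ∘ j 0, h, (hh 0).comp (hj 0), hh, fun n x => ?_⟩
  induction n with
  | zero => rfl
  | succ n ih => exact (hcomm n x).symm.trans ih

end Sequences

end Gluing

/-- Two metric spaces embedded isometrically into a third one, which is the union of their images:
a metric on the disjoint union of `X` and `Y` in which points of `X` and `Y` may be at distance
zero. -/
structure Coupling (X Y : Type u) [MetricSpace X] [MetricSpace Y] where
  space : Type u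
  [metric : MetricSpace space]
  inl : X → space
  inr : Y → space
  isometry_inl : Isometry inl
  isometry_inr : Isometry inr
  range_union_range : Set.range inl ∪ Set.range inr = Set.univ

attribute [instance] Coupling.metric

namespace Coupling

variable {X Y : Type u} [MetricSpace X] [MetricSpace Y] (C : Coupling X Y)

instance [CompactSpace X] [CompactSpace Y] : CompactSpace C.space where
  isCompact_univ := C.range_union_range ▸
    (isCompact_range C.isometry_inl.continuous).union (isCompact_range C.isometry_inr.continuous)

theorem hausdorffEDist_range_inl_univ_le : Metric.hausdorffEDist (Set.range C.inl) Set.univ ≤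
    Metric.hausdorffEDist (Set.range C.inl) (Set.range C.inr) := by
  refine Metric.hausdorffEDist_le_of_infEDist (fun z _ => ?_) fun z _ => ?_
  · simp [Metric.infEDist_zero_of_mem (Set.mem_univ z)]
  · rcases (C.range_union_range.ge (Set.mem_univ z)) with hz | hz
    · simp [Metric.infEDist_zero_of_mem hz]
    · rw [Metric.hausdorffEDist_comm]
      exact Metric.infEDist_le_hausdorffEDist_of_mem hz

/-- The same coupling with the roles of the two spaces interchanged. -/
def symm : Coupling Y X where
  space := C.space
  inl := C.inr
  inr := C.inl
  isometry_inl := C.isometry_inr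
  isometry_inr := C.isometry_inl
  range_union_range := (Set.union_comm _ _).trans C.range_union_range

theorem hausdorffEDist_range_inr_univ_le : Metric.hausdorffEDist (Set.range C.inr) Set.univ ≤
    Metric.hausdorffEDist (Set.range C.inl) (Set.range C.inr) :=
  C.symm.hausdorffEDist_range_inl_univ_le.trans Metric.hausdorffEDist_comm.le

theorem exists_of_isometry {Z : Type u} [MetricSpace Z] {f : X → Z} (hf : Isometry f) {g : Y → Z}
    (hg : Isometry g) : ∃ (C : Coupling X Y) (i : C.space → Z),
      Isometry i ∧ (∀ x, i (C.inl x) = f x) ∧ ∀ y, i (C.inr y) = g y := by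
  let C : Coupling X Y :=
    { space := ↥(Set.range f ∪ Set.range g)
      inl x := ⟨f x, Or.inl ⟨x, rfl⟩⟩
      inr y := ⟨g y, Or.inr ⟨y, rfl⟩⟩
      isometry_inl x x' := hf x x'
      isometry_inr y y' := hg y y'
      range_union_range := by
        refine Set.eq_univ_of_forall ?_
        rintro ⟨_, ⟨x, rfl⟩ | ⟨y, rfl⟩⟩
        · exact Or.inl ⟨x, rfl⟩
        · exact Or.inr ⟨y, rfl⟩ }
  exact ⟨C, Subtype.val, isometry_subtype_coe, fun _ => rfl, fun _ => rfl⟩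

end Coupling

namespace MetricFunctor

variable {σ : MetricFunctor.{u, v}} {X Y Z W : Type u} [MetricSpace X] [CompactSpace X]
  [MetricSpace Y] [CompactSpace Y] [MetricSpace Z] [CompactSpace Z] [MetricSpace W] [CompactSpace W]

theorem map_map_of_comp_eq {f : X → Y} {g : Y → Z} {h : X → Z} (hf : Isometry f) (hg : Isometry g)
    (hh : Isometry h) (e : ∀ x, g (f x) = h x) (a : σ.obj X) :
    σ.map g hg (σ.map f hf a) = σ.map h hh a := by
  obtain rfl : g ∘ f = h := funext e
  exact (σ.map_comp f hf g hg a).symm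

theorem edist_map_map_of_comp_eq {f : X → W} {g : Y → W} {i : W → Z} {f' : X → Z} {g' : Y → Z}
    (hf : Isometry f) (hg : Isometry g) (hi : Isometry i) (hf' : Isometry f') (hg' : Isometry g')
    (ef : ∀ x, i (f x) = f' x) (eg : ∀ y, i (g y) = g' y) (a : σ.obj X) (b : σ.obj Y) :
    edist (σ.map f' hf' a) (σ.map g' hg' b) = edist (σ.map f hf a) (σ.map g hg b) := by
  rw [← (σ.isometry_map i hi).edist_eq, map_map_of_comp_eq hf hi hf' ef,
    map_map_of_comp_eq hg hi hg' eg]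

theorem ghf_le {f : X → Z} (hf : Isometry f) {g : Y → Z} (hg : Isometry g) (a : σ.obj X)
    (b : σ.obj Y) : σ.ghf a b ≤ max (Metric.hausdorffEDist (Set.range f) (Set.range g))
      (edist (σ.map f hf a) (σ.map g hg b)) :=
  iInf_le_of_le Z <| iInf_le_of_le ‹_› <| iInf_le_of_le ‹_› <| iInf_le_of_le f <|
    iInf_le_of_le hf <| iInf_le_of_le g <| iInf_le _ hg

theorem exists_coupling_of_ghf_lt {a : σ.obj X} {b : σ.obj Y} {c : ℝ≥0∞} (h : σ.ghf a b < c) :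
    ∃ C : Coupling X Y, Metric.hausdorffEDist (Set.range C.inl) (Set.range C.inr) < c ∧
      edist (σ.map C.inl C.isometry_inl a) (σ.map C.inr C.isometry_inr b) < c := by
  simp only [ghf, iInf_lt_iff] at h
  obtain ⟨Z, _, _, f, hf, g, hg, h⟩ := h
  obtain ⟨C, i, hi, hil, hir⟩ := Coupling.exists_of_isometry hf hg
  refine ⟨C, ?_, ?_⟩
  · rw [← Metric.hausdorffEDist_image hi, ← Set.range_comp, ← Set.range_comp,
      (funext hil : i ∘ C.inl = f), (funext hir : i ∘ C.inr = g)]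
    exact (max_lt_iff.1 h).1
  · rw [← edist_map_map_of_comp_eq _ _ hi hf hg hil hir]
    exact (max_lt_iff.1 h).2

theorem ghf_comm (a : σ.obj X) (b : σ.obj Y) : σ.ghf a b = σ.ghf b a := by
  have ghf_le_swap {X Y : Type u} [MetricSpace X] [CompactSpace X] [MetricSpace Y] [CompactSpace Y]
      (a : σ.obj X) (b : σ.obj Y) : σ.ghf a b ≤ σ.ghf b a := by
    refine le_of_forall_gt fun c hc => ?_
    obtain ⟨C, hC, hab⟩ := exists_coupling_of_ghf_lt hc
    refine (ghf_le C.isometry_inr C.isometry_inl a b).trans_lt (max_lt ?_ ?_)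
    · rwa [Metric.hausdorffEDist_comm]
    · rwa [edist_comm]
  exact le_antisymm (ghf_le_swap a b) (ghf_le_swap b a)

theorem ghf_eq_zero_of_map_eq {f : X → Y} (hf : Isometry f) (hf' : Function.Surjective f)
    {a : σ.obj X} {b : σ.obj Y} (h : σ.map f hf a = b) : σ.ghf a b = 0 := by
  simpa [h, hf'.range_eq, σ.map_id] using ghf_le hf isometry_id a b

theorem ghf_triangle [Nonempty Y] (a : σ.obj X) (b : σ.obj Y) (c : σ.obj Z) :
    σ.ghf a c ≤ σ.ghf a b + σ.ghf b c := by
  refine ENNReal.le_of_forall_pos_le_add fun ε hε hlt => ?_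
  have hε' : (ε / 2 : ℝ≥0∞) ≠ 0 := by simpa using hε.ne'
  obtain ⟨C, hC, hab⟩ := exists_coupling_of_ghf_lt
    (ENNReal.lt_add_right (ENNReal.add_lt_top.1 hlt).1.ne hε')
  obtain ⟨D, hD, hbc⟩ := exists_coupling_of_ghf_lt
    (ENNReal.lt_add_right (ENNReal.add_lt_top.1 hlt).2.ne hε')
  have := compactSpace_glueSpace C.isometry_inr D.isometry_inl
  have hp := Metric.toGlueL_isometry C.isometry_inr D.isometry_inl
  have hq := Metric.toGlueR_isometry C.isometry_inr D.isometry_inl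
  set p := Metric.toGlueL C.isometry_inr D.isometry_inl
  set q := Metric.toGlueR C.isometry_inr D.isometry_inl
  have hpq : p ∘ C.inr = q ∘ D.inl := Metric.toGlue_commute _ _
  have hsum : σ.ghf a b + ε / 2 + (σ.ghf b c + ε / 2) = σ.ghf a b + σ.ghf b c + ε := by
    rw [add_add_add_comm, ENNReal.add_halves]
  refine (ghf_le (hp.comp C.isometry_inl) (hq.comp D.isometry_inr) a c).trans
    (hsum.subst (max_le ?_ ?_))
  · refine (Metric.hausdorffEDist_triangle (t := Set.range (p ∘ C.inr))).trans
      (add_le_add ?_ ?_)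
    · rw [Set.range_comp, Set.range_comp, Metric.hausdorffEDist_image hp]
      exact hC.le
    · rw [hpq, Set.range_comp, Set.range_comp, Metric.hausdorffEDist_image hq]
      exact hD.le
  · refine (edist_triangle _ (σ.map (p ∘ C.inr) (hp.comp C.isometry_inr) b) _).trans
      (add_le_add ?_ ?_)
    · rw [σ.map_comp _ C.isometry_inl _ hp, σ.map_comp _ C.isometry_inr _ hp,
        (σ.isometry_map p hp).edist_eq]
      exact hab.le
    · rw [← map_map_of_comp_eq D.isometry_inl hq (hp.comp C.isometry_inr)
        (fun y => (congrFun hpq y).symm), σ.map_comp _ D.isometry_inr _ hq,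
        (σ.isometry_map q hq).edist_eq]
      exact hbc.le

end MetricFunctor

theorem tendsto_inv_two_pow : Tendsto (fun n => (2⁻¹ : ℝ≥0∞) ^ n) atTop (𝓝 0) :=
  ENNReal.tendsto_pow_atTop_nhds_zero_of_lt_one (by simp)

theorem tendsto_zero_of_le_inv_two_pow {u : ℕ → ℝ≥0∞} (h : ∀ n, u n ≤ 2⁻¹ ^ n) :
    Tendsto u atTop (𝓝 0) :=
  tendsto_of_tendsto_of_tendsto_of_le_of_le tendsto_const_nhds tendsto_inv_two_pow
    (fun _ => zero_le) h

theorem exists_tendsto_of_edist_le_inv_two_pow {X : Type*} [PseudoEMetricSpace X]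
    [CompleteSpace X] {u : ℕ → X} (h : ∀ n, edist (u n) (u (n + 1)) ≤ 2⁻¹ ^ n) :
    ∃ x, Tendsto u atTop (𝓝 x) :=
  cauchySeq_tendsto_of_complete <|
    cauchySeq_of_edist_le_geometric 2⁻¹ 1 (by simp) (by simp) (by simpa using h)

/-- A sequence of compact spaces, dense with respect to the Gromov–Hausdorff distance; Mathlib's
Gromov–Hausdorff space lives in `Type`, hence the lift. -/
abbrev denseCompact (n : ℕ) : Type u :=
  ULift.{u} (denseSeq GromovHausdorff.GHSpace n).Rep

theorem exists_coupling_denseCompact (X : Type u) [MetricSpace X] [CompactSpace X] [Nonempty X]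
    {c : ℝ} (hc : 0 < c) : ∃ (n : ℕ) (C : Coupling X (denseCompact.{u} n)),
      Metric.hausdorffEDist (Set.range C.inl) (Set.range C.inr) < ENNReal.ofReal c := by
  obtain ⟨n, hn⟩ := (denseRange_denseSeq GromovHausdorff.GHSpace).exists_dist_lt
    (GromovHausdorff.toGHSpace X) hc
  rw [← GromovHausdorff.GHSpace.toGHSpace_rep (denseSeq GromovHausdorff.GHSpace n)] at hn
  obtain ⟨Φ, Ψ, hΦ, hΨ, hΦΨ⟩ := GromovHausdorff.ghDist_eq_hausdorffDist X
    (denseSeq GromovHausdorff.GHSpace n).Rep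
  have hne : Metric.hausdorffEDist (Set.range Φ) (Set.range Ψ) ≠ ∞ :=
    Metric.hausdorffEDist_ne_top_of_nonempty_of_bounded (Set.range_nonempty _)
      (Set.range_nonempty _) (isCompact_range hΦ.continuous).isBounded
      (isCompact_range hΨ.continuous).isBounded
  have hlt : Metric.hausdorffEDist (Set.range Φ) (Set.range Ψ) < ENNReal.ofReal c :=
    (ENNReal.lt_ofReal_iff_toReal_lt hne).2 (hΦΨ.symm.trans_lt hn)
  have hup : Isometry (ULift.up.{u} : lp (fun _ : ℕ => ℝ) ∞ → _) := fun _ _ => rfl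
  have hdown : Isometry (ULift.down : denseCompact.{u} n → _) := fun _ _ => rfl
  obtain ⟨C, i, hi, hl, hr⟩ :=
    Coupling.exists_of_isometry (hup.comp hΦ) ((hup.comp hΨ).comp hdown)
  refine ⟨n, C, ?_⟩
  rwa [← Metric.hausdorffEDist_image hi, ← Set.range_comp, ← Set.range_comp,
    (funext hl : i ∘ C.inl = _), (funext hr : i ∘ C.inr = _), ULift.down_surjective.range_comp,
    Set.range_comp, Set.range_comp, Metric.hausdorffEDist_image hup]

namespace MetricFunctor

variable {σ : MetricFunctor.{u, v}}

theorem HausdorffContinuous.imageClosed (hσ : σ.HausdorffContinuous)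
    (hcomplete : ∀ (X : Type u) [MetricSpace X] [CompactSpace X], CompleteSpace (σ.obj X)) :
    σ.ImageClosed := by
  intro Z X _ _ _ _ Xn _ _ f hf fn hfn h b a hb
  have := hcomplete X
  refine mem_of_tendsto_of_tendsto_infEDist (σ.isometry_map f hf).isClosedEmbedding.isClosed_range
    hb ?_
  exact tendsto_of_tendsto_of_tendsto_of_le_of_le tendsto_const_nhds (hσ Z X Xn f hf fn hfn h)
    (fun _ => zero_le) fun n => Metric.infEDist_le_hausdorffEDist_of_mem (Set.mem_range_self (a n))

theorem ImageClosed.exists_tendsto_ghf (hσ : σ.ImageClosed)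
    (hcomplete : ∀ (X : Type u) [MetricSpace X] [CompactSpace X], CompleteSpace (σ.obj X))
    {X : ℕ → Type u} [∀ n, MetricSpace (X n)] [∀ n, CompactSpace (X n)] [∀ n, Nonempty (X n)]
    (a : ∀ n, σ.obj (X n)) (ha : ∀ n, σ.ghf (a n) (a (n + 1)) < 2⁻¹ ^ n) :
    ∃ (L : Type u) (_ : MetricSpace L) (_ : CompactSpace L) (b : σ.obj L),
      Tendsto (fun n => σ.ghf (a n) b) atTop (𝓝 0) := by
  choose C hC hCa using fun n => exists_coupling_of_ghf_lt (ha n)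
  obtain ⟨Z, _, _, h, hh, hlr⟩ := exists_compact_glue (fun n => (C n).isometry_inl)
    (fun n => (C n).isometry_inr)
    (fun n => (C n).hausdorffEDist_range_inl_univ_le.trans (hC n).le)
    (fun n => (C n).hausdorffEDist_range_inr_univ_le.trans (hC n).le)
  let f (n : ℕ) : X n → Z := h n ∘ (C n).inl
  have hf (n : ℕ) : Isometry (f n) := (hh n).comp (C n).isometry_inl
  have hf_succ (n : ℕ) : h n ∘ (C n).inr = f (n + 1) := funext (hlr n)
  let K (n : ℕ) : NonemptyCompacts Z :=
    ⟨⟨Set.range (f n), isCompact_range (hf n).continuous⟩, Set.range_nonempty (f n)⟩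
  obtain ⟨L, hL⟩ := exists_tendsto_of_edist_le_inv_two_pow (u := K) fun n => by
    change Metric.hausdorffEDist (Set.range (f n)) (Set.range (f (n + 1))) ≤ _
    rw [← hf_succ, Set.range_comp, Set.range_comp, Metric.hausdorffEDist_image (hh n)]
    exact (hC n).le
  have := hcomplete Z
  obtain ⟨z, hz⟩ := exists_tendsto_of_edist_le_inv_two_pow
      (u := fun n => σ.map (f n) (hf n) (a n)) fun n => by
    rw [edist_map_map_of_comp_eq (C n).isometry_inl (C n).isometry_inr (hh n) (hf n) (hf (n + 1))
      (fun _ => rfl) (hlr n)]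
    exact (hCa n).le
  have hval : Isometry (Subtype.val : L → Z) := isometry_subtype_coe
  have hL' : Tendsto (fun n => Metric.hausdorffEDist (Set.range (f n))
      (Set.range (Subtype.val : L → Z))) atTop (𝓝 0) :=
    (tendsto_iff_edist_tendsto_0.1 hL).congr fun n => congrArg _ Subtype.range_coe.symm
  obtain ⟨b, rfl⟩ := hσ Z L X _ hval f hf hL' z a hz
  refine ⟨L, inferInstance, isCompact_iff_compactSpace.1 L.isCompact, b, ?_⟩
  refine tendsto_of_tendsto_of_tendsto_of_le_of_le tendsto_const_nhds ?_ (fun _ => zero_le)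
    fun n => ghf_le (hf n) hval (a n) b
  simpa using hL'.max (tendsto_iff_edist_tendsto_0.1 hz)

section Embedding

variable {X Y : Type u} [MetricSpace X] [CompactSpace X] [MetricSpace Y] [CompactSpace Y]

theorem exists_common_extension_of_ghf_lt {Q : Type u} [MetricSpace Q] [CompactSpace Q]
    [Nonempty Q] {j : Q → Y} (hj : Isometry j) {q : σ.obj Q} {a : σ.obj X} {c : ℝ≥0∞}
    (h : σ.ghf q a < c) :
    ∃ (W : Type u) (_ : MetricSpace W) (_ : CompactSpace W) (f : X → W) (hf : Isometry f)
      (g : Y → W) (hg : Isometry g), Metric.hausdorffEDist (Set.range g) Set.univ ≤ c ∧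
      edist (σ.map f hf a) (σ.map g hg (σ.map j hj q)) ≤ c := by
  obtain ⟨C, hC, hqa⟩ := exists_coupling_of_ghf_lt h
  have := compactSpace_glueSpace C.isometry_inl hj
  have hp := Metric.toGlueL_isometry C.isometry_inl hj
  have hg := Metric.toGlueR_isometry C.isometry_inl hj
  have hcomm := congrFun (Metric.toGlue_commute C.isometry_inl hj)
  refine ⟨_, _, this, _, hp.comp C.isometry_inr, _, hg,
    Metric.hausdorffEDist_le_of_infEDist (fun w _ => ?_) ?_, ?_⟩
  · simp [Metric.infEDist_zero_of_mem (Set.mem_univ w)]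
  · rintro ⟨z | y⟩ -
    · calc Metric.infEDist (Metric.toGlueL C.isometry_inl hj z) (Set.range _)
        _ ≤ Metric.infEDist (Metric.toGlueL C.isometry_inl hj z)
            (Metric.toGlueL C.isometry_inl hj '' Set.range C.inl) := by
          refine Metric.infEDist_anti ?_
          rintro _ ⟨_, ⟨x, rfl⟩, rfl⟩
          exact ⟨j x, (hcomm x).symm⟩
        _ = Metric.infEDist z (Set.range C.inl) := Metric.infEDist_image hp
        _ ≤ Metric.hausdorffEDist Set.univ (Set.range C.inl) :=
          Metric.infEDist_le_hausdorffEDist_of_mem (Set.mem_univ z)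
        _ ≤ c := by
          rw [Metric.hausdorffEDist_comm]
          exact C.hausdorffEDist_range_inl_univ_le.trans hC.le
    · exact (Metric.infEDist_zero_of_mem (Set.mem_range_self y)).trans_le zero_le
  · rw [map_map_of_comp_eq hj hg (hp.comp C.isometry_inl) (fun x => (hcomm x).symm),
      σ.map_comp _ C.isometry_inl _ hp, σ.map_comp _ C.isometry_inr _ hp,
      (σ.isometry_map _ hp).edist_eq, edist_comm]
    exact hqa.le

theorem PointwiseContinuous.exists_isometry_map_mem (hσ : σ.PointwiseContinuous) [Nonempty Y]
    {a : σ.obj X} {S : Set (σ.obj Y)} (hS : IsCompact S)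
    (h : ∀ c : ℝ≥0∞, 0 < c → ∃ (Q : Type u) (_ : MetricSpace Q) (_ : CompactSpace Q)
      (_ : Nonempty Q) (q : σ.obj Q) (j : Q → Y) (hj : Isometry j),
      σ.map j hj q ∈ S ∧ σ.ghf q a < c) :
    ∃ (e : X → Y) (he : Isometry e), σ.map e he a ∈ S := by
  have h' (n : ℕ) : ∃ (W : Type u) (_ : MetricSpace W) (_ : CompactSpace W) (f : X → W)
      (hf : Isometry f) (g : Y → W) (hg : Isometry g) (s : σ.obj Y),
      Metric.hausdorffEDist (Set.range g) Set.univ ≤ 2⁻¹ ^ n ∧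
      edist (σ.map f hf a) (σ.map g hg s) ≤ 2⁻¹ ^ n ∧ s ∈ S := by
    obtain ⟨Q, _, _, _, q, j, hj, hq, hqa⟩ := h (2⁻¹ ^ n) (ENNReal.pow_pos (by simp) n)
    obtain ⟨W, _, _, f, hf, g, hg, hW, hfg⟩ := exists_common_extension_of_ghf_lt hj hqa
    exact ⟨W, _, ‹_›, f, hf, g, hg, _, hW, hfg, hq⟩
  choose W iM iC f hf g hg s hW hfg hs using h'
  obtain ⟨Z, _, _, G, k, hG, hk, hkG⟩ := exists_compact_star_glue hg hW
  have hkf (n : ℕ) : Isometry (k n ∘ f n) := (hk n).comp (hf n)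
  obtain ⟨e', φ, he', hφ, hlim⟩ := exists_subseq_tendsto_isometry _ hkf
  have infEDist_range_le (n : ℕ) (x : X) :
      Metric.infEDist (k n (f n x)) (Set.range G) ≤ 2⁻¹ ^ n := by
    rw [← (funext (hkG n) : k n ∘ g n = G), Set.range_comp, Metric.infEDist_image (hk n)]
    refine (Metric.infEDist_le_hausdorffEDist_of_mem (Set.mem_univ _)).trans ?_
    exact Metric.hausdorffEDist_comm.trans_le (hW n)
  have infEDist_image_le (n : ℕ) :
      Metric.infEDist (σ.map _ (hkf n) a) (σ.map G hG '' S) ≤ 2⁻¹ ^ n := by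
    refine (Metric.infEDist_le_edist_of_mem (Set.mem_image_of_mem _ (hs n))).trans ?_
    rw [edist_map_map_of_comp_eq (hf n) (hg n) (hk n) (hkf n) hG (fun _ => rfl) (hkG n)]
    exact hfg n
  obtain ⟨e, he, hGe⟩ := exists_isometry_lift hG he' fun x =>
    mem_of_tendsto_of_tendsto_infEDist (isCompact_range hG.continuous).isClosed (hlim x) <|
      (tendsto_zero_of_le_inv_two_pow (infEDist_range_le · x)).comp hφ.tendsto_atTop
  obtain ⟨s, hsS, hs⟩ : σ.map e' he' a ∈ σ.map G hG '' S :=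
    mem_of_tendsto_of_tendsto_infEDist (hS.image (σ.isometry_map G hG).continuous).isClosed
      (hσ X Z e' he' _ (fun n => hkf (φ n)) hlim a) <|
      (tendsto_zero_of_le_inv_two_pow infEDist_image_le).comp hφ.tendsto_atTop
  rw [← map_map_of_comp_eq he hG he' hGe] at hs
  exact ⟨e, he, (σ.isometry_map G hG).injective hs ▸ hsS⟩

end Embedding

theorem HausdorffContinuous.exists_ghf_denseCompact_le (hσ : σ.HausdorffContinuous)
    {S : ∀ n, Set (σ.obj (denseCompact.{u} n))} (hS : ∀ n, Dense (S n)) {X : Type u}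
    [MetricSpace X] [CompactSpace X] [Nonempty X] (a : σ.obj X) {c : ℝ≥0∞} (hc : 0 < c) :
    ∃ n, ∃ p ∈ S n, σ.ghf a p ≤ c := by
  choose n C hC using fun k : ℕ => exists_coupling_denseCompact X (c := 2⁻¹ ^ k) (by positivity)
  replace hC (k : ℕ) :
      Metric.hausdorffEDist (Set.range (C k).inl) (Set.range (C k).inr) ≤ 2⁻¹ ^ k := by
    have := (hC k).le
    rwa [ENNReal.ofReal_pow (by norm_num), ENNReal.ofReal_inv_of_pos (by norm_num),
      ENNReal.ofReal_ofNat] at this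
  obtain ⟨Z, _, _, f, h, hf, hh, hhf⟩ := exists_compact_star_glue (fun k => (C k).isometry_inl)
    fun k => (C k).hausdorffEDist_range_inl_univ_le.trans (hC k)
  let g (k : ℕ) : denseCompact.{u} (n k) → Z := h k ∘ (C k).inr
  have hg (k : ℕ) : Isometry (g k) := (hh k).comp (C k).isometry_inr
  have hlim : Tendsto (fun k => Metric.hausdorffEDist (Set.range (g k)) (Set.range f)) atTop
      (𝓝 0) := tendsto_zero_of_le_inv_two_pow fun k => by
    rw [← (funext (hhf k) : h k ∘ (C k).inl = f), Set.range_comp, Set.range_comp,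
      Metric.hausdorffEDist_image (hh k), Metric.hausdorffEDist_comm]
    exact hC k
  have hc2 := ENNReal.half_pos hc.ne'
  obtain ⟨k, hk, hσk⟩ := ((hlim.eventually (gt_mem_nhds hc2)).and
    ((hσ Z X _ f hf g hg hlim).eventually (gt_mem_nhds hc2))).exists
  rw [Metric.hausdorffEDist_comm] at hk hσk
  obtain ⟨_, ⟨t, rfl⟩, ht⟩ :=
    Metric.exists_edist_lt_of_hausdorffEDist_lt (Set.mem_range_self a) hσk
  obtain ⟨p, hp, htp⟩ := EMetric.mem_closure_iff.1 (hS (n k) t) (c / 2) hc2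
  refine ⟨n k, p, hp, (ghf_le hf (hg k) a p).trans
    (max_le (hk.le.trans ENNReal.half_le_self) ?_)⟩
  calc edist (σ.map f hf a) (σ.map (g k) (hg k) p)
    _ ≤ _ := edist_triangle _ (σ.map (g k) (hg k) t) _
    _ ≤ c / 2 + c / 2 := by
      rw [(σ.isometry_map _ (hg k)).edist_eq]
      exact add_le_add ht.le htp.le
    _ = c := ENNReal.add_halves c

theorem PointwiseContinuous.pointed (hσ : σ.PointwiseContinuous) :
    σ.pointed.PointwiseContinuous :=
  fun X Y _ _ _ _ f hf fn hfn h a => (h a.1).prodMk_nhds (hσ X Y f hf fn hfn h a.2)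

theorem HausdorffContinuous.pointed (hσ : σ.HausdorffContinuous) :
    σ.pointed.HausdorffContinuous := by
  intro Z X _ _ _ _ Xn _ _ f hf fn hfn h
  refine tendsto_of_tendsto_of_tendsto_of_le_of_le tendsto_const_nhds
    (by simpa using h.max (hσ Z X Xn f hf fn hfn h)) (fun _ => zero_le) fun n => ?_
  change Metric.hausdorffEDist (Set.range (Prod.map (fn n) (σ.map (fn n) (hfn n))))
    (Set.range (Prod.map f (σ.map f hf))) ≤ _
  rw [Set.range_prodMap, Set.range_prodMap]
  exact Metric.hausdorffEDist_prod_le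

theorem completeSpace_pointed
    (hcomplete : ∀ (X : Type u) [MetricSpace X] [CompactSpace X], CompleteSpace (σ.obj X))
    (X : Type u) [MetricSpace X] [CompactSpace X] : CompleteSpace (σ.pointed.obj X) :=
  have := hcomplete X
  inferInstanceAs (CompleteSpace (X × σ.obj X))

end MetricFunctor

section CompactTuples

variable {τ : PosFunctor.{u, v}}

instance (A : CompactTuple τ) : Nonempty A.carrier := ⟨A.origin⟩

theorem CompactTuple.exists_radius (A : CompactTuple τ) (r : ℝ≥0) :
    ∃ R, r ≤ R ∧ ∀ x : A.carrier, dist x A.origin ≤ R := by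
  obtain ⟨R, hR⟩ := (isCompact_univ (X := A.carrier)).isBounded.subset_closedBall A.origin
  exact ⟨max r R.toNNReal, le_max_left _ _, fun x =>
    (hR (Set.mem_univ x)).trans ((Real.le_coe_toNNReal R).trans (le_max_right _ _))⟩

namespace Truncation

variable (T : Truncation τ) {X Y Z : Type u} [MetricSpace X] [CompactSpace X] [MetricSpace Y]
  [CompactSpace Y] [MetricSpace Z] [CompactSpace Z]

theorem map_le_iff {f : X → Y} (hf : Isometry f) {a : τ.obj X} {b : τ.obj Y} :
    τ.map f hf a ≤ b ↔ a ≤ T.trunc f hf b :=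
  ⟨fun h => T.trunc_map f hf a ▸ T.monotone_trunc f hf h,
    fun h => (τ.monotone_map f hf h).trans (T.map_trunc_le f hf b)⟩

theorem trunc_trunc_of_comp_eq {f : X → Y} {g : Y → Z} {h : X → Z} (hf : Isometry f)
    (hg : Isometry g) (hh : Isometry h) (e : ∀ x, g (f x) = h x) (c : τ.obj Z) :
    T.trunc f hf (T.trunc g hg c) = T.trunc h hh c := by
  obtain rfl : g ∘ f = h := funext e
  exact (T.trunc_comp f hf g hg c).symm

end Truncation

/-- `f` is an isometric embedding that exhibits `A` as a tuple on a compact subset of `B` whose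
structure is below that of `B`, that is, `A ≼ B` up to isomorphism. -/
structure IsLowerEmbedding (A B : CompactTuple τ) (f : A.carrier → B.carrier) : Prop where
  isometry : Isometry f
  map_origin : f A.origin = B.origin
  map_str_le : τ.map f isometry A.str ≤ B.str

/-- `B^(r) ≼ A ≼ B`, up to isomorphism: `f` is a lower embedding, and every lower embedding into the
ball of radius `r` of `B` factors through it. -/
structure IsSandwich (r : ℝ≥0) (A B : CompactTuple τ) (f : A.carrier → B.carrier) : Prop
    extends IsLowerEmbedding A B f where
  exists_lift : ∀ (D : CompactTuple τ) (h : D.carrier → B.carrier), IsLowerEmbedding D B h →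
    (∀ x, dist (h x) B.origin ≤ r) → ∃ h', IsLowerEmbedding D A h' ∧ ∀ x, f (h' x) = h x

variable {A B C D : CompactTuple τ} {f : A.carrier → B.carrier} {g : B.carrier → C.carrier}
  {h : A.carrier → C.carrier} {r s : ℝ≥0}

namespace IsLowerEmbedding

protected theorem id (A : CompactTuple τ) : IsLowerEmbedding A A id :=
  ⟨isometry_id, rfl, (τ.map_id A.str).le⟩

theorem comp (hg : IsLowerEmbedding B C g) (hf : IsLowerEmbedding A B f) :
    IsLowerEmbedding A C (g ∘ f) where
  isometry := hg.isometry.comp hf.isometry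
  map_origin := (congrArg g hf.map_origin).trans hg.map_origin
  map_str_le := by
    rw [τ.map_comp f hf.isometry g hg.isometry]
    exact (τ.monotone_map _ _ hf.map_str_le).trans hg.map_str_le

theorem dist_map_origin (hf : IsLowerEmbedding A B f) (x : A.carrier) :
    dist (f x) B.origin = dist x A.origin := by
  rw [← hf.map_origin, hf.isometry.dist_eq]

theorem iterate {e : D.carrier → D.carrier} (he : IsLowerEmbedding D D e) (n : ℕ) :
    IsLowerEmbedding D D e^[n] := by
  induction n with
  | zero => exact .id D
  | succ n ih => exact ih.comp he

-- Iterates of `e` converge to the identity, and the structure of `D` lies in the closed cone below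
-- `τ e D.str` as the limit of its images under these iterates.
theorem exists_inverse (hτ : τ.PointwiseContinuous) {e : D.carrier → D.carrier}
    (he : IsLowerEmbedding D D e) :
    ∃ e' : D.carrier → D.carrier, IsLowerEmbedding D D e' ∧ ∀ x, e (e' x) = x := by
  obtain ⟨φ, hφ⟩ := exists_iterate_tendsto_id he.isometry
  have hlim := hτ _ _ id isometry_id _ (fun n => (he.iterate (φ n + 1)).isometry) hφ D.str
  rw [τ.map_id] at hlim
  have str_le : D.str ≤ τ.map e he.isometry D.str :=
    (τ.isCompact_cone _).isClosed.mem_of_tendsto hlim <| Eventually.of_forall fun n => by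
      have hn := he.iterate (φ n)
      change τ.map e^[φ n + 1] _ D.str ≤ _
      rw [← MetricFunctor.map_map_of_comp_eq hn.isometry he.isometry _
        (fun x => (Function.iterate_succ_apply' e (φ n) x).symm)]
      exact τ.monotone_map _ _ hn.map_str_le
  obtain ⟨e', he', hee'⟩ :=
    exists_isometry_lift he.isometry isometry_id (surjective_of_isometry he.isometry)
  refine ⟨e', ⟨he', he.isometry.injective ?_, (τ.monotone_map e' he' str_le).trans_eq ?_⟩, hee'⟩
  · rw [hee', he.map_origin, id]
  · exact map_map_eq_self _ _ (fun x => he.isometry.injective (hee' (e x))) _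

end IsLowerEmbedding

namespace IsSandwich

protected theorem id (r : ℝ≥0) (A : CompactTuple τ) : IsSandwich r A A id :=
  ⟨.id A, fun _ h hh _ => ⟨h, hh, fun _ => rfl⟩⟩

theorem mono (hf : IsSandwich r A B f) (hs : s ≤ r) : IsSandwich s A B f :=
  ⟨hf.1, fun D h hh hb => hf.2 D h hh fun x => (hb x).trans (NNReal.coe_le_coe.2 hs)⟩

theorem comp (hg : IsSandwich r B C g) (hf : IsSandwich r A B f) : IsSandwich r A C (g ∘ f) := by
  refine ⟨hg.1.comp hf.1, fun D h hh hb => ?_⟩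
  obtain ⟨k, hk, hgk⟩ := hg.exists_lift D h hh hb
  obtain ⟨l, hl, hfl⟩ := hf.exists_lift D k hk fun x => by
    rw [← hg.dist_map_origin, hgk]
    exact hb x
  exact ⟨l, hl, fun x => by rw [Function.comp, hfl, hgk]⟩

theorem inner_of_comp (hh : IsSandwich r A C h) (hg : IsLowerEmbedding B C g)
    (hf : IsLowerEmbedding A B f) (e : ∀ x, g (f x) = h x) : IsSandwich r A B f := by
  refine ⟨hf, fun D k hk hb => ?_⟩
  obtain ⟨l, hl, hhl⟩ := hh.exists_lift D (g ∘ k) (hg.comp hk) fun x => by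
    rw [Function.comp, hg.dist_map_origin]
    exact hb x
  exact ⟨l, hl, fun x => hg.isometry.injective ((e _).trans (hhl x))⟩

theorem outer_of_comp (hh : IsSandwich r A C h) (hg : IsLowerEmbedding B C g)
    (hf : IsLowerEmbedding A B f) (e : ∀ x, g (f x) = h x) : IsSandwich r B C g := by
  refine ⟨hg, fun D k hk hb => ?_⟩
  obtain ⟨l, hl, hhl⟩ := hh.exists_lift D k hk hb
  exact ⟨f ∘ l, hf.comp hl, fun x => (e _).trans (hhl x)⟩

theorem of_trunc (T : Truncation τ) (hf : Isometry f) (ho : f A.origin = B.origin)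
    (hs : A.str = T.trunc f hf B.str) (hr : ∀ y, dist y B.origin ≤ r → y ∈ Set.range f) :
    IsSandwich r A B f := by
  refine ⟨⟨hf, ho, (T.map_le_iff hf).2 hs.le⟩, fun D h hh hb => ?_⟩
  obtain ⟨h', ih, eh⟩ := exists_isometry_lift hf hh.isometry fun x => hr _ (hb x)
  refine ⟨h', ⟨ih, hf.injective ?_, ?_⟩, eh⟩
  · rw [eh, hh.map_origin, ho]
  · rw [hs, ← T.map_le_iff, MetricFunctor.map_map_of_comp_eq ih hf hh.isometry eh]
    exact hh.map_str_le

end IsSandwich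

theorem dc_comm (A B : CompactTuple τ) : dc A B = dc B A :=
  MetricFunctor.ghf_comm _ _

theorem dc_triangle (A B C : CompactTuple τ) : dc A C ≤ dc A B + dc B C :=
  MetricFunctor.ghf_triangle _ _ _

theorem dc_eq_zero_of_map_eq {f : A.carrier → B.carrier} (hf : Isometry f)
    (hf' : Function.Surjective f) (ho : f A.origin = B.origin) (hs : τ.map f hf A.str = B.str) :
    dc A B = 0 :=
  MetricFunctor.ghf_eq_zero_of_map_eq hf hf' (Prod.ext ho hs)

theorem dc_self (A : CompactTuple τ) : dc A A = 0 :=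
  dc_eq_zero_of_map_eq isometry_id Function.surjective_id rfl (τ.map_id A.str)

theorem exists_nnreal_eq_of_lt_half {x : ℝ≥0∞} {ε : ℝ≥0} (h : x < (ε : ℝ≥0∞) / 2) :
    ∃ η : ℝ≥0, x = η ∧ 2 * η < ε := by
  lift x to ℝ≥0 using h.ne_top
  refine ⟨x, rfl, ?_⟩
  rwa [ENNReal.lt_div_iff_mul_lt (by simp) (by simp), mul_comm, ← ENNReal.coe_ofNat,
    ← ENNReal.coe_mul, ENNReal.coe_lt_coe] at h

theorem dist_origin_le_of_dc_lt {δ : ℝ≥0} {r : ℝ} (h : dc A B < (δ : ℝ≥0∞) / 2)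
    (hA : ∀ x, dist x A.origin ≤ r) (y : B.carrier) : dist y B.origin ≤ r + δ := by
  have dist_lt_half {Z : Type u} [MetricSpace Z] {x y : Z}
      (hxy : edist x y < (δ : ℝ≥0∞) / 2) : dist x y < δ / 2 := by
    obtain ⟨η, hη, hηδ⟩ := exists_nnreal_eq_of_lt_half hxy
    rw [edist_nndist, ENNReal.coe_inj] at hη
    rw [← coe_nndist, hη, lt_div_iff₀' two_pos]
    exact_mod_cast hηδ
  obtain ⟨M, hM, hstr⟩ := MetricFunctor.exists_coupling_of_ghf_lt h
  rw [Metric.hausdorffEDist_comm] at hM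
  obtain ⟨_, ⟨x, rfl⟩, hx⟩ :=
    Metric.exists_edist_lt_of_hausdorffEDist_lt (Set.mem_range_self y) hM
  have hyx := dist_lt_half hx
  have ho : dist (M.inl A.origin) (M.inr B.origin) < δ / 2 :=
    dist_lt_half ((le_max_left _ _).trans_lt hstr)
  have hxo := hA x
  rw [← M.isometry_inl.dist_eq] at hxo
  rw [← M.isometry_inr.dist_eq]
  linarith [dist_triangle4 (M.inr y) (M.inl x) (M.inl A.origin) (M.inr B.origin)]

end CompactTuples

section Tuples

variable {τ : PosFunctor.{u, v}} {T : Truncation τ}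

/-- The tuple `𝒳^(r)`: the closed ball of radius `r`, as a compact tuple in its own right. -/
def Tuple.compactBall (𝒳 : Tuple T) (r : ℝ≥0) : CompactTuple τ := (𝒳.ball r).toCompactTuple

theorem dist_origin_le_of_compactBall (𝒳 : Tuple T) (r : ℝ≥0) (x : (𝒳.compactBall r).carrier) :
    dist x (𝒳.compactBall r).origin ≤ r := x.2

theorem ball_carrier_mono (𝒳 : Tuple T) : Monotone fun r => (𝒳.ball r).carrier :=
  fun _ _ h => Metric.closedBall_subset_closedBall (NNReal.coe_le_coe.2 h)

/-- `𝒳^(r) ≼ A ≼ 𝒳`, up to isomorphism. -/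
def IsSandwiched (r : ℝ≥0) (A : CompactTuple τ) (𝒳 : Tuple T) : Prop :=
  ∃ R, r ≤ R ∧ ∃ f, IsSandwich r A (𝒳.compactBall R) f

variable {𝒳 𝒴 : Tuple T} {A B : CompactTuple τ} {r s R : ℝ≥0}

theorem isSandwich_compactBall (𝒳 : Tuple T) (h : r ≤ s) :
    IsSandwich r (𝒳.compactBall r) (𝒳.compactBall s) (incl (ball_carrier_mono 𝒳 h)) :=
  .of_trunc T (isometry_incl _) rfl (𝒳.str.compat _ _ _).symm fun y hy => ⟨⟨y.1, hy⟩, rfl⟩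

theorem isSandwich_toTuple_compactBall (T : Truncation τ) (A : CompactTuple τ) (r : ℝ≥0) :
    IsSandwich r ((A.toTuple T).compactBall r) A Subtype.val :=
  .of_trunc T isometry_subtype_coe rfl rfl fun y hy => ⟨⟨y, hy⟩, rfl⟩

theorem IsSandwich.mem_range (T : Truncation τ) {f : A.carrier → B.carrier}
    (hf : IsSandwich r A B f) {y : B.carrier} (hy : dist y B.origin ≤ r) : y ∈ Set.range f := by
  obtain ⟨h, -, hfh⟩ :=
    hf.exists_lift _ _ (isSandwich_toTuple_compactBall T B r).1 fun x => x.2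
  exact ⟨h ⟨y, hy⟩, hfh ⟨y, hy⟩⟩

theorem IsSandwich.trunc_eq (T : Truncation τ) {f : A.carrier → B.carrier}
    (hf : IsSandwich r A B f) {K : Type u} [MetricSpace K] [CompactSpace K]
    {p : K → A.carrier} (hp : Isometry p) {q : K → B.carrier} (hq : Isometry q)
    (e : ∀ x, f (p x) = q x) (hb : ∀ x, dist (p x) A.origin ≤ r) :
    T.trunc p hp A.str = T.trunc q hq B.str := by
  apply le_antisymm
  · rw [← T.trunc_trunc_of_comp_eq hp hf.isometry hq e]
    exact T.monotone_trunc _ _ ((T.map_le_iff _).1 hf.map_str_le)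
  · have hD := isSandwich_toTuple_compactBall T B r
    obtain ⟨h, hh, hfh⟩ := hf.exists_lift _ _ hD.1 fun x => x.2
    let k : K → ((B.toTuple T).compactBall r).carrier := fun x => ⟨q x, by
      change dist (q x) B.origin ≤ r
      rw [← e, hf.dist_map_origin]
      exact hb x⟩
    have hk : Isometry k := hq
    calc T.trunc q hq B.str
      _ = T.trunc k hk (T.trunc (Y := B.carrier) _ hD.isometry B.str) :=
        (T.trunc_trunc_of_comp_eq hk hD.isometry hq (fun _ => rfl) _).symm
      _ ≤ T.trunc k hk (T.trunc h hh.isometry A.str) :=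
        T.monotone_trunc k hk ((T.map_le_iff hh.isometry).1 hh.map_str_le)
      _ = T.trunc p hp A.str :=
        T.trunc_trunc_of_comp_eq hk hh.isometry hp
          (fun x => hf.isometry.injective ((hfh _).trans (e x).symm)) _

namespace IsSandwiched

theorem compactBall (𝒳 : Tuple T) (r : ℝ≥0) : IsSandwiched r (𝒳.compactBall r) 𝒳 :=
  ⟨r, le_rfl, id, .id r _⟩

theorem mono (h : IsSandwiched r A 𝒳) (hs : s ≤ r) : IsSandwiched s A 𝒳 := by
  obtain ⟨R, hR, f, hf⟩ := h
  exact ⟨R, hs.trans hR, f, hf.mono hs⟩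

theorem comp {f : A.carrier → B.carrier} (h : IsSandwiched r B 𝒳) (hf : IsSandwich r A B f) :
    IsSandwiched r A 𝒳 := by
  obtain ⟨R, hR, g, hg⟩ := h
  exact ⟨R, hR, g ∘ f, hg.comp hf⟩

theorem exists_isSandwich (h : IsSandwiched r A 𝒳) (hA : ∀ x, dist x A.origin ≤ R) :
    ∃ f, IsSandwich r A (𝒳.compactBall R) f := by
  obtain ⟨R₀, hR₀, f, hf⟩ := h
  have h₀ := isSandwich_compactBall 𝒳 (le_max_left R₀ R)
  have h₁ := isSandwich_compactBall 𝒳 (le_max_right R₀ R)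
  obtain ⟨g, hg, hfg⟩ := h₁.exists_lift A _ (h₀.1.comp hf.1) fun x => by
    rw [(h₀.1.comp hf.1).dist_map_origin]
    exact hA x
  exact ⟨g, ((h₀.mono hR₀).comp hf).inner_of_comp h₁.1 hg hfg⟩

theorem exists_piece (h : IsSandwiched r A 𝒳) :
    ∃ P : Piece 𝒳, (𝒳.ball r).Le P ∧ P.Below ∧ dc A P.toCompactTuple = 0 := by
  obtain ⟨R, hR, f, hf⟩ := h
  obtain ⟨k, hk, hfk⟩ := hf.exists_lift _ _ (isSandwich_compactBall 𝒳 hR).1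
    (dist_origin_le_of_compactBall 𝒳 r)
  let K : Compacts 𝒳.carrier := ⟨Set.range fun x => (f x).1,
    isCompact_range (continuous_subtype_val.comp hf.isometry.continuous)⟩
  let p : A.carrier → K := fun x => ⟨(f x).1, x, rfl⟩
  have hp : Isometry p := hf.isometry
  have hpo : (p A.origin).1 = 𝒳.origin := congrArg Subtype.val hf.map_origin
  have hK : K ≤ (𝒳.ball R).carrier := by
    rintro _ ⟨x, rfl⟩
    exact (f x).2
  have hrK : (𝒳.ball r).carrier ≤ K := fun x hx => ⟨k ⟨x, hx⟩, congrArg Subtype.val (hfk ⟨x, hx⟩)⟩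
  refine ⟨⟨K, ⟨A.origin, hpo⟩, τ.map p hp A.str⟩, ⟨hrK, ?_⟩, ?_, ?_⟩
  · refine (T.map_le_iff (isometry_incl hrK)).1
      (le_of_eq_of_le ?_ (τ.monotone_map p hp hk.map_str_le))
    exact (MetricFunctor.map_map_of_comp_eq hk.isometry hp (isometry_incl hrK)
      (fun x => Subtype.ext (show (f (k x)).1 = x.1 from congrArg Subtype.val (hfk x))) _).symm
  · change τ.map p hp A.str ≤ 𝒳.str.val K
    rw [← 𝒳.str.compat _ _ hK, ← T.map_le_iff,
      MetricFunctor.map_map_of_comp_eq hp (isometry_incl hK) hf.isometry fun _ => rfl]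
    exact hf.map_str_le
  · exact dc_eq_zero_of_map_eq hp (fun ⟨_, x, hx⟩ => ⟨x, Subtype.ext hx⟩) (Subtype.ext hpo) rfl

end IsSandwiched

theorem Piece.isSandwiched {P : Piece 𝒳} (h : (𝒳.ball r).Le P) (hP : P.Below) :
    IsSandwiched r P.toCompactTuple 𝒳 := by
  obtain ⟨R, hR⟩ := P.carrier.isCompact.isBounded.subset_closedBall 𝒳.origin
  have hPR : P.carrier ≤ (𝒳.ball (max r R.toNNReal)).carrier := fun x hx =>
    (hR hx).trans ((Real.le_coe_toNNReal R).trans (NNReal.coe_le_coe.2 (le_max_right _ _)))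
  have hsub : IsLowerEmbedding P.toCompactTuple (𝒳.compactBall (max r R.toNNReal)) (incl hPR) :=
    ⟨isometry_incl hPR, rfl, (T.map_le_iff (isometry_incl hPR)).2 <|
      hP.trans_eq (𝒳.str.compat _ _ hPR).symm⟩
  obtain ⟨hrP, hstr⟩ := h
  have hball : IsLowerEmbedding (𝒳.compactBall r) P.toCompactTuple (incl hrP) :=
    ⟨isometry_incl hrP, rfl, (T.map_le_iff (isometry_incl hrP)).2 hstr⟩
  exact ⟨_, le_max_left _ _, _,
    (isSandwich_compactBall 𝒳 (le_max_left _ _)).outer_of_comp hsub hball fun _ => rfl⟩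

theorem isSandwiched_toTuple_iff :
    IsSandwiched r A (B.toTuple T) ↔ ∃ f, IsSandwich r A B f := by
  constructor
  · rintro ⟨R, hR, f, hf⟩
    exact ⟨_, ((isSandwich_toTuple_compactBall T B R).mono hR).comp hf⟩
  · rintro ⟨f, hf⟩
    obtain ⟨R, hrR, hR⟩ := B.exists_radius r
    have hball := isSandwich_toTuple_compactBall T B R
    obtain ⟨g, hg, hfg⟩ := hball.exists_lift A f hf.1 fun x => hR (f x)
    exact ⟨R, hrR, g, hf.inner_of_comp hball.1 hg hfg⟩

theorem aFun_lt_iff {ε : ℝ≥0} {c : ℝ≥0∞} : aFun ε 𝒳 𝒴 < c ↔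
    ∃ A, IsSandwiched (ε⁻¹ - ε) A 𝒴 ∧ dc (𝒳.compactBall ε⁻¹) A < c := by
  simp only [aFun, iInf_lt_iff]
  constructor
  · rintro ⟨P, hball, hP, h⟩
    exact ⟨_, P.isSandwiched hball hP, h⟩
  · rintro ⟨A, hA, h⟩
    obtain ⟨P, hball, hP, hAP⟩ := hA.exists_piece
    refine ⟨P, hball, hP, (dc_triangle _ A _).trans_lt ?_⟩
    rwa [hAP, add_zero]

theorem Truncation.BallSubsetProperty.exists_isSandwich (hT : T.BallSubsetProperty)
    {A' : CompactTuple τ} {f : A'.carrier → A.carrier} {ε : ℝ≥0} (hf : IsSandwich r A' A f)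
    (hd : dc A B ≤ ε) (hr : 2 * ε ≤ r) :
    ∃ (B' : CompactTuple τ) (g : B'.carrier → B.carrier), IsSandwich (r - 2 * ε) B' B g ∧
      dc A' B' ≤ ε := by
  obtain ⟨P, hball, hP, hAP⟩ := (isSandwiched_toTuple_iff (T := T).2 ⟨f, hf⟩).exists_piece
  obtain ⟨δ, hδ⟩ : ∃ δ : ℝ≥0, (δ : ℝ≥0∞) = dc A B :=
    ⟨_, ENNReal.coe_toNNReal (ne_top_of_le_ne_top ENNReal.coe_ne_top hd)⟩
  have hδε : 2 * δ ≤ 2 * ε := mul_le_mul_right (ENNReal.coe_le_coe.1 (hδ.trans_le hd)) 2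
  obtain ⟨Q, hQball, hQ, hPQ⟩ := hT A B P r δ hδ.symm (hδε.trans hr) hball hP
  obtain ⟨g, hg⟩ := isSandwiched_toTuple_iff.1 (Q.isSandwiched hQball hQ)
  refine ⟨Q.toCompactTuple, g, hg.mono (tsub_le_tsub_left hδε r), ?_⟩
  calc dc A' Q.toCompactTuple
    _ ≤ dc A' P.toCompactTuple + dc P.toCompactTuple Q.toCompactTuple := dc_triangle _ _ _
    _ ≤ ε := by
      rw [hAP, zero_add]
      exact hPQ.trans hd

end Tuples

section Closeness

variable {τ : PosFunctor.{u, v}} {T : Truncation τ} {𝒳 𝒴 𝒵 : Tuple T} {A B : CompactTuple τ}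
  {δ ε r s : ℝ≥0}

/-- `𝒳` is `ε`-close to `𝒴`, in the asymmetric sense given by `a_ε(𝒳, 𝒴)`. -/
def Close (ε : ℝ≥0) (𝒳 𝒴 : Tuple T) : Prop := aFun ε 𝒳 𝒴 < (ε : ℝ≥0∞) / 2

theorem inv_add_add_le_inv (hε : 0 < ε) (hδ : 0 < δ) (h : ε + δ ≤ 1) :
    (ε + δ)⁻¹ + ε ≤ δ⁻¹ := by
  have hle : ε ≤ ε / (δ * (ε + δ)) :=
    le_div_self hε.le (by positivity) (mul_le_one' (le_add_self.trans h) h)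
  calc (ε + δ)⁻¹ + ε
    _ ≤ (ε + δ)⁻¹ + ε / (δ * (ε + δ)) := by gcongr
    _ = δ⁻¹ := by
      field_simp
      ring

namespace Close

protected theorem refl (hε : 0 < ε) (𝒳 : Tuple T) : Close ε 𝒳 𝒳 := by
  refine aFun_lt_iff.2 ⟨_, (IsSandwiched.compactBall 𝒳 _).mono tsub_le_self, ?_⟩
  rw [dc_self]
  exact ENNReal.half_pos (ENNReal.coe_ne_zero.2 hε.ne')

theorem exists_isSandwiched (hT : T.BallSubsetProperty) (h : Close δ 𝒳 𝒴)
    (hA : IsSandwiched s A 𝒳) (hb : ∀ x, dist x A.origin ≤ (δ⁻¹ : ℝ≥0)) (hs : r + δ ≤ s)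
    (hr : r + δ ≤ δ⁻¹) : ∃ A', IsSandwiched r A' 𝒴 ∧ dc A A' < (δ : ℝ≥0∞) / 2 := by
  obtain ⟨B, hB, hd⟩ := aFun_lt_iff.1 h
  obtain ⟨η, hη, hηδ⟩ := exists_nnreal_eq_of_lt_half hd
  obtain ⟨f, hf⟩ := hA.exists_isSandwich hb
  obtain ⟨A', k, hk, hAA'⟩ :=
    hT.exists_isSandwich hf hη.le (hηδ.le.trans (le_add_self.trans hs))
  have hrs : r ≤ s - 2 * η := le_tsub_of_add_le_right ((add_le_add le_rfl hηδ.le).trans hs)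
  exact ⟨A', (hB.mono (le_tsub_of_add_le_right hr)).comp (hk.mono hrs), hAA'.trans_lt (hη ▸ hd)⟩

theorem triangle (hT : T.BallSubsetProperty) (hε : 0 < ε) (hδ : 0 < δ) (hεδ : ε + δ ≤ 1)
    (h : Close ε 𝒳 𝒴) (h' : Close δ 𝒴 𝒵) : Close (ε + δ) 𝒳 𝒵 := by
  have hle : ε + δ ≤ (ε + δ)⁻¹ := hεδ.trans ((one_le_inv₀ (by positivity)).2 hεδ)
  have hleε : (ε + δ)⁻¹ ≤ ε⁻¹ := inv_anti₀ hε le_self_add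
  have hleδ : (ε + δ)⁻¹ + ε ≤ δ⁻¹ := inv_add_add_le_inv hε hδ hεδ
  have hsub : (ε + δ)⁻¹ - ε + ε = (ε + δ)⁻¹ := tsub_add_cancel_of_le (le_self_add.trans hle)
  have hsub' : (ε + δ)⁻¹ - (ε + δ) + δ ≤ (ε + δ)⁻¹ - ε :=
    le_tsub_of_add_le_right (by rw [add_assoc, add_comm δ ε, tsub_add_cancel_of_le hle])
  obtain ⟨A, hA, hdA⟩ := h.exists_isSandwiched hT (.compactBall 𝒳 (ε + δ)⁻¹)
    (fun x => (dist_origin_le_of_compactBall _ _ x).trans (NNReal.coe_le_coe.2 hleε))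
    hsub.le (hsub.le.trans hleε)
  have hbA (x : A.carrier) : dist x A.origin ≤ (δ⁻¹ : ℝ≥0) :=
    (dist_origin_le_of_dc_lt hdA (dist_origin_le_of_compactBall _ _) x).trans
      (NNReal.coe_le_coe.2 hleδ)
  obtain ⟨B, hB, hdB⟩ := h'.exists_isSandwiched hT hA hbA hsub'
    (hsub'.trans (tsub_le_self.trans (le_self_add.trans hleδ)))
  refine aFun_lt_iff.2 ⟨B, hB, (dc_triangle _ A _).trans_lt ?_⟩
  rw [ENNReal.coe_add, ENNReal.add_div]
  exact ENNReal.add_lt_add hdA hdB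

theorem mono (hT : T.BallSubsetProperty) (hε : 0 < ε) (hεδ : ε ≤ δ) (hδ : δ ≤ 1)
    (h : Close ε 𝒳 𝒴) : Close δ 𝒳 𝒴 := by
  rcases hεδ.eq_or_lt with rfl | hlt
  · exact h
  · have hsum : ε + (δ - ε) = δ := add_tsub_cancel_of_le hεδ
    rw [← hsum]
    exact h.triangle hT hε (tsub_pos_of_lt hlt) (hsum.trans_le hδ) (.refl (tsub_pos_of_lt hlt) 𝒴)

theorem of_isSandwiched (hT : T.BallSubsetProperty) (hε : 0 < ε) (hε₁ : ε ≤ 1)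
    (hA : IsSandwiched r A 𝒳) (hB : IsSandwiched r B 𝒴) (hd : dc A B < (ε : ℝ≥0∞) / 2)
    (hr : ε⁻¹ ≤ r) : Close ε 𝒳 𝒴 := by
  obtain ⟨η, hη, hηε⟩ := exists_nnreal_eq_of_lt_half hd
  obtain ⟨R, hR, f, hf⟩ := hA
  have hball := isSandwich_compactBall 𝒳 (hr.trans hR)
  obtain ⟨g, hg, hfg⟩ := hf.exists_lift _ _ hball.1 fun x =>
    (dist_origin_le_of_compactBall 𝒳 ε⁻¹ x).trans (NNReal.coe_le_coe.2 hr)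
  obtain ⟨B', k, hk, hd'⟩ := hT.exists_isSandwich (hball.inner_of_comp hf.1 hg hfg) hη.le
    (hηε.le.trans (hε₁.trans ((one_le_inv₀ hε).2 hε₁)))
  exact aFun_lt_iff.2 ⟨B', (hB.mono (tsub_le_self.trans hr)).comp
    (hk.mono (tsub_le_tsub_left hηε.le _)), hd'.trans_lt (hη ▸ hd)⟩

end Close

theorem dist_le_of_close (hε : 0 < ε) (hε₁ : ε ≤ 1) (h : Close ε 𝒳 𝒴) (h' : Close ε 𝒴 𝒳) :
    𝒳.dist 𝒴 ≤ ε :=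
  csInf_le (OrderBot.bddBelow _) (Or.inr ⟨hε, hε₁, max_lt h h'⟩)

theorem dist_le_of_isSandwiched (hT : T.BallSubsetProperty) (hε : 0 < ε) (hε₁ : ε ≤ 1)
    (hA : IsSandwiched r A 𝒳) (hB : IsSandwiched r B 𝒴) (hd : dc A B < (ε : ℝ≥0∞) / 2)
    (hr : ε⁻¹ ≤ r) : 𝒳.dist 𝒴 ≤ ε :=
  dist_le_of_close hε hε₁ (.of_isSandwiched hT hε hε₁ hA hB hd hr)
    (.of_isSandwiched hT hε hε₁ hB hA (by rwa [dc_comm]) hr)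

theorem close_and_close_of_dist_lt (hT : T.BallSubsetProperty) (hε : ε ≤ 1) (h : 𝒳.dist 𝒴 < ε) :
    Close ε 𝒳 𝒴 ∧ Close ε 𝒴 𝒳 := by
  obtain ⟨δ, hδ, hlt⟩ := exists_lt_of_csInf_lt (Set.insert_nonempty _ _) h
  rcases hδ with rfl | ⟨hδ₀, -, hδ⟩
  · exact absurd hlt hε.not_gt
  · exact ⟨.mono hT hδ₀ hlt.le hε (max_lt_iff.1 hδ).1, .mono hT hδ₀ hlt.le hε (max_lt_iff.1 hδ).2⟩

end Closeness

section Limits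

variable {τ : PosFunctor.{u, v}} {T : Truncation τ} {A B D : CompactTuple τ} {r s : ℝ≥0}

theorem exists_isLowerEmbedding_of_forall_dc_lt (hτ : τ.PointwiseContinuous)
    (h : ∀ c > 0, ∃ Q j, IsLowerEmbedding Q B j ∧ dc Q A < c) : ∃ j, IsLowerEmbedding A B j := by
  have hcompact : IsCompact ({B.origin} ×ˢ {b | b ≤ B.str} : Set (B.carrier × τ.obj B.carrier)) :=
    isCompact_singleton.prod (τ.isCompact_cone B.str)
  obtain ⟨e, he, horigin, hstr⟩ := hτ.pointed.exists_isometry_map_mem (X := A.carrier)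
    (a := (A.origin, A.str)) hcompact fun c hc => by
      obtain ⟨Q, j, hj, hQ⟩ := h c hc
      exact ⟨Q.carrier, inferInstance, inferInstance, inferInstance, (Q.origin, Q.str), j,
        hj.isometry, ⟨hj.map_origin, hj.map_str_le⟩, hQ⟩
  exact ⟨e, he, horigin, hstr⟩

theorem exists_isSandwich_dc_lt (hT : T.BallSubsetProperty) (hsr : s < r)
    (h : ∀ c > 0, ∃ A' B' f, IsSandwich r A' B' f ∧ dc A' A < c ∧ dc B' B < c) {c : ℝ≥0∞}
    (hc : 0 < c) : ∃ Q g, IsSandwich s Q B g ∧ dc Q A < c := by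
  obtain ⟨A', B', f, hf, hA, hB⟩ := h (min (c / 2) (((r - s : ℝ≥0) : ℝ≥0∞) / 2)) <|
    lt_min (ENNReal.half_pos hc.ne')
      (ENNReal.half_pos (ENNReal.coe_ne_zero.2 (tsub_pos_of_lt hsr).ne'))
  obtain ⟨η, hη, hηrs⟩ := exists_nnreal_eq_of_lt_half (hB.trans_le (min_le_right _ _))
  obtain ⟨Q, g, hg, hQ⟩ := hT.exists_isSandwich hf hη.le (hηrs.le.trans tsub_le_self)
  have hsη : s ≤ r - 2 * η :=
    le_tsub_of_add_le_left ((add_le_add hηrs.le le_rfl).trans_eq (tsub_add_cancel_of_le hsr.le))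
  refine ⟨Q, g, hg.mono hsη, (dc_triangle Q A' A).trans_lt ?_⟩
  rw [dc_comm, ← ENNReal.add_halves c]
  exact ENNReal.add_lt_add ((hQ.trans_eq hη.symm).trans_lt (hB.trans_le (min_le_left _ _)))
    (hA.trans_le (min_le_left _ _))

theorem IsLowerEmbedding.isSandwich (hτ : τ.PointwiseContinuous) {j : A.carrier → B.carrier}
    (hj : IsLowerEmbedding A B j) {i : D.carrier → A.carrier} (hi : IsLowerEmbedding D A i)
    {k : D.carrier → B.carrier} (hk : IsSandwich s D B k) (hD : ∀ x, dist x D.origin ≤ s) :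
    IsSandwich s A B j := by
  obtain ⟨e, he, hke⟩ := hk.exists_lift D _ (hj.comp hi) fun x => by
    rw [(hj.comp hi).dist_map_origin]
    exact hD x
  obtain ⟨e', he', hinv⟩ := he.exists_inverse hτ
  refine hk.outer_of_comp hj (hi.comp he') fun x => ?_
  calc j (i (e' x)) = k (e (e' x)) := (hke _).symm
    _ = k x := by rw [hinv]

-- A ball `D` of `B` is the sandwich `D → Q → B` in each `Q` that approximates `A`, and hence close
-- to tuples below `A`.
theorem exists_isSandwich_of_forall_dc_lt (hT : T.BallSubsetProperty)
    (hτ : τ.PointwiseContinuous) (hsr : s < r)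
    (h : ∀ c > 0, ∃ A' B' f, IsSandwich r A' B' f ∧ dc A' A < c ∧ dc B' B < c) :
    ∃ f, IsSandwich s A B f := by
  obtain ⟨t, hst, htr⟩ := exists_between hsr
  have approx {c : ℝ≥0∞} (hc : 0 < c) := exists_isSandwich_dc_lt hT htr h hc
  obtain ⟨j, hj⟩ : ∃ j, IsLowerEmbedding A B j :=
    exists_isLowerEmbedding_of_forall_dc_lt hτ fun c hc => by
      obtain ⟨Q, g, hg, hQ⟩ := approx hc
      exact ⟨Q, g, hg.1, hQ⟩
  have hD := isSandwich_toTuple_compactBall T B t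
  obtain ⟨i, hi⟩ : ∃ i, IsLowerEmbedding ((B.toTuple T).compactBall t) A i :=
    exists_isLowerEmbedding_of_forall_dc_lt hτ fun c hc => by
      obtain ⟨Q, g, hg, hQ⟩ := approx (lt_min hc
        (ENNReal.half_pos (ENNReal.coe_ne_zero.2 (bot_le.trans_lt hst).ne')))
      obtain ⟨η, hη, hηt⟩ := exists_nnreal_eq_of_lt_half (hQ.trans_le (min_le_right _ _))
      obtain ⟨l, hl, hgl⟩ := hg.exists_lift _ _ hD.1 fun x => x.2
      obtain ⟨R, m, hm, hR⟩ :=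
        hT.exists_isSandwich (hD.inner_of_comp hg.1 hl hgl) hη.le hηt.le
      refine ⟨R, m, hm.1, ?_⟩
      rw [dc_comm]
      exact (hR.trans_eq hη.symm).trans_lt (hQ.trans_le (min_le_left _ _))
  exact ⟨j, (hj.isSandwich hτ hi hD (dist_origin_le_of_compactBall _ t)).mono hst.le⟩

end Limits

section Exhaustions

variable {τ : PosFunctor.{u, v}}

/-- `X`, based at `o`, is the increasing union of the images of the `A k` under the `i k`. As
compact tuples, the `A k` are nested, and each of them contains the balls of radius `ρ k` of the
later ones, where `ρ k → ∞`. -/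
structure IsExhaustion {X : Type u} [MetricSpace X] (o : X) (A : ℕ → CompactTuple τ)
    (ρ : ℕ → ℝ≥0) (i : ∀ k, (A k).carrier → X) : Prop where
  isometry : ∀ k, Isometry (i k)
  map_origin : ∀ k, i k (A k).origin = o
  exists_isSandwich : ∀ {k m}, k ≤ m →
    ∃ g, IsSandwich (ρ k) (A k) (A m) g ∧ ∀ x, i m (g x) = i k x
  exists_map_eq : ∀ x, ∃ k y, i k y = x
  tendsto_radius : Tendsto ρ atTop atTop

theorem exists_isExhaustion {A : ℕ → CompactTuple τ} {ρ : ℕ → ℝ≥0} (hρ : Monotone ρ)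
    (hρ' : Tendsto ρ atTop atTop) {f : ∀ k, (A k).carrier → (A (k + 1)).carrier}
    (hf : ∀ k, IsSandwich (ρ k) (A k) (A (k + 1)) (f k)) :
    ∃ (X : Type u) (_ : MetricSpace X) (o : X) (i : ∀ k, (A k).carrier → X),
      IsExhaustion o A ρ i := by
  have hiso (k : ℕ) : Isometry (f k) := (hf k).isometry
  let i := Metric.toInductiveLimit hiso
  have hif (k : ℕ) (x : (A k).carrier) : i (k + 1) (f k x) = i k x :=
    congrFun (Metric.toInductiveLimit_commute hiso k) x
  refine ⟨Metric.InductiveLimit hiso, inferInstance, i 0 (A 0).origin, i,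
    Metric.toInductiveLimit_isometry hiso, fun k => ?_, fun {k m} hkm => ?_,
    by rintro ⟨k, x⟩; exact ⟨k, x, rfl⟩, hρ'⟩
  · induction k with
    | zero => rfl
    | succ k ih => rw [← (hf k).map_origin, hif, ih]
  · induction m, hkm using Nat.le_induction with
    | base => exact ⟨id, .id _ _, fun _ => rfl⟩
    | succ m hkm ih =>
      obtain ⟨g, hg, hig⟩ := ih
      exact ⟨f m ∘ g, ((hf m).mono (hρ hkm)).comp hg, fun x => (hif m (g x)).trans (hig x)⟩

namespace IsExhaustion

variable {X : Type u} [MetricSpace X] {o : X} {A : ℕ → CompactTuple τ} {ρ : ℕ → ℝ≥0}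
  {i : ∀ k, (A k).carrier → X}

theorem dist_map_origin (h : IsExhaustion o A ρ i) {k : ℕ} (x : (A k).carrier) :
    dist (i k x) o = dist x (A k).origin := by
  rw [← h.map_origin k, (h.isometry k).dist_eq]

theorem mem_range (T : Truncation τ) (h : IsExhaustion o A ρ i) {k : ℕ} {x : X}
    (hx : dist x o ≤ ρ k) : x ∈ Set.range (i k) := by
  obtain ⟨m, y, rfl⟩ := h.exists_map_eq x
  rcases le_total m k with hmk | hkm
  · obtain ⟨g, -, hig⟩ := h.exists_isSandwich hmk
    exact ⟨g y, hig y⟩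
  · obtain ⟨g, hg, hig⟩ := h.exists_isSandwich hkm
    rw [h.dist_map_origin] at hx
    obtain ⟨z, rfl⟩ := hg.mem_range T hx
    exact ⟨z, (hig z).symm⟩

theorem properSpace (T : Truncation τ) (h : IsExhaustion o A ρ i) : ProperSpace X :=
  .of_seq_closedBall (NNReal.tendsto_coe_atTop.2 h.tendsto_radius) <| .of_forall fun k =>
    (isCompact_range (h.isometry k).continuous).of_isClosed_subset Metric.isClosed_closedBall
      fun _ hx => h.mem_range T hx

theorem trunc_eq (T : Truncation τ) (h : IsExhaustion o A ρ i) {K : Type u} [MetricSpace K]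
    [CompactSpace K] {k m : ℕ} {p : K → (A k).carrier} (hp : Isometry p) {q : K → (A m).carrier}
    (hq : Isometry q) (e : ∀ x, i k (p x) = i m (q x)) (hpk : ∀ x, dist (i k (p x)) o ≤ ρ k)
    (hqm : ∀ x, dist (i m (q x)) o ≤ ρ m) : T.trunc p hp (A k).str = T.trunc q hq (A m).str := by
  wlog hkm : k ≤ m generalizing k m
  · exact (this hq hp (fun x => (e x).symm) hqm hpk (le_of_not_ge hkm)).symm
  obtain ⟨g, hg, hig⟩ := h.exists_isSandwich hkm
  refine hg.trunc_eq T hp hq (fun x => (h.isometry m).injective ?_) fun x => ?_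
  · rw [hig, e]
  · rw [← h.dist_map_origin]
    exact hpk x

theorem exists_phi (T : Truncation τ) (h : IsExhaustion o A ρ i) :
    ∃ a : Phi T X, ∀ (K : Compacts X) (k : ℕ) (e : K → (A k).carrier) (he : Isometry e),
      (∀ x, i k (e x) = x) → (∀ x : K, dist (x : X) o ≤ ρ k) →
        a.val K = T.trunc e he (A k).str := by
  have hlift (K : Compacts X) : ∃ (k : ℕ) (e : K → (A k).carrier), Isometry e ∧
      (∀ x, i k (e x) = x) ∧ ∀ x : K, dist (x : X) o ≤ ρ k := by
    obtain ⟨R, hR⟩ := K.isCompact.isBounded.subset_closedBall o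
    obtain ⟨k, hk⟩ := (h.tendsto_radius.eventually_ge_atTop R.toNNReal).exists
    have hKk (x : K) : dist (x : X) o ≤ ρ k :=
      (hR x.2).trans ((Real.le_coe_toNNReal R).trans (NNReal.coe_le_coe.2 hk))
    obtain ⟨e, he, hie⟩ := exists_isometry_lift (h.isometry k) isometry_subtype_coe
      fun x => h.mem_range T (hKk x)
    exact ⟨k, e, he, hie, hKk⟩
  choose κ e he hie hκ using hlift
  have key (K L : Compacts X) (hKL : K ≤ L) (k : ℕ) (e' : K → (A k).carrier)
      (he' : Isometry e') (hie' : ∀ x, i k (e' x) = x) (hk : ∀ x : K, dist (x : X) o ≤ ρ k) :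
      T.trunc (incl hKL) (isometry_incl hKL) (T.trunc (e L) (he L) (A (κ L)).str) =
        T.trunc e' he' (A k).str := by
    rw [T.trunc_trunc_of_comp_eq (isometry_incl hKL) (he L) ((he L).comp (isometry_incl hKL))
      fun _ => rfl]
    have hieL (x : K) : i (κ L) ((e L ∘ incl hKL) x) = x := hie L (incl hKL x)
    refine h.trunc_eq T _ he' (fun x => (hieL x).trans (hie' x).symm) (fun x => ?_) fun x => ?_
    · rw [hieL]
      exact hκ L (incl hKL x)
    · rw [hie']
      exact hk x
  refine ⟨⟨fun K => T.trunc (e K) (he K) (A (κ K)).str,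
    fun K L hKL => key K L hKL _ _ _ (hie K) (hκ K)⟩, fun K k e' he' hie' hk => ?_⟩
  rw [← key K K le_rfl k e' he' hie' hk]
  exact (T.trunc_id _).symm

theorem exists_tuple (T : Truncation τ) (h : IsExhaustion o A ρ i) :
    ∃ 𝒳 : Tuple T, ∀ k, IsSandwiched (ρ k) (A k) 𝒳 := by
  have := h.properSpace T
  obtain ⟨a, ha⟩ := h.exists_phi T
  let 𝒳 : Tuple T := ⟨X, o, a⟩
  refine ⟨𝒳, fun k => ?_⟩
  obtain ⟨R, hkR, hR⟩ := (A k).exists_radius (ρ k)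
  obtain ⟨m, hkm, hRm⟩ :=
    ((eventually_ge_atTop k).and (h.tendsto_radius.eventually_ge_atTop R)).exists
  have hball (x : 𝒳.compactBall R |>.carrier) : dist x.1 o ≤ ρ m :=
    (dist_origin_le_of_compactBall 𝒳 R x).trans (NNReal.coe_le_coe.2 hRm)
  obtain ⟨l, hl, hil⟩ := exists_isometry_lift (h.isometry m)
    (g := (Subtype.val : (𝒳.compactBall R).carrier → X)) isometry_subtype_coe
    fun x => h.mem_range T (hball x)
  have hlm : IsSandwich R (𝒳.compactBall R) (A m) l := by
    refine .of_trunc T hl ((h.isometry m).injective ((hil _).trans (h.map_origin m).symm))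
      (ha _ m l hl hil hball) fun y hy => ?_
    rw [← h.dist_map_origin] at hy
    exact ⟨⟨i m y, hy⟩, (h.isometry m).injective (hil _)⟩
  obtain ⟨g, hg, -⟩ := h.exists_isSandwich hkm
  obtain ⟨p, hp, hlp⟩ := hlm.exists_lift (A k) g hg.1 fun x => by
    rw [hg.dist_map_origin]
    exact hR x
  exact ⟨R, hkR, p, hg.inner_of_comp hlm.1 hp hlp⟩

end IsExhaustion

end Exhaustions

section Metric

variable {τ : PosFunctor.{u, v}} {T : Truncation τ}

theorem Tuple.dist_le_one (𝒳 𝒴 : Tuple T) : 𝒳.dist 𝒴 ≤ 1 :=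
  csInf_le (OrderBot.bddBelow _) (Set.mem_insert _ _)

theorem Tuple.dist_self (𝒳 : Tuple T) : 𝒳.dist 𝒳 = 0 :=
  nonpos_iff_eq_zero.1 <| le_of_forall_gt_imp_ge_of_dense fun ε hε => by
    rcases le_total ε 1 with hε₁ | hε₁
    · exact dist_le_of_close hε hε₁ (.refl hε 𝒳) (.refl hε 𝒳)
    · exact (𝒳.dist_le_one 𝒳).trans hε₁

theorem Tuple.dist_comm (𝒳 𝒴 : Tuple T) : 𝒳.dist 𝒴 = 𝒴.dist 𝒳 := by
  simp only [Tuple.dist, max_comm]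

theorem Tuple.dist_triangle (hT : T.BallSubsetProperty) (𝒳 𝒴 𝒵 : Tuple T) :
    𝒳.dist 𝒵 ≤ 𝒳.dist 𝒴 + 𝒴.dist 𝒵 := by
  refine le_of_forall_pos_le_add fun η hη => ?_
  set ε := 𝒳.dist 𝒴 + η / 2 with hε
  set δ := 𝒴.dist 𝒵 + η / 2 with hδ
  have hεδ : 𝒳.dist 𝒴 + 𝒴.dist 𝒵 + η = ε + δ := by
    rw [hε, hδ, add_add_add_comm, add_halves]
  rw [hεδ]
  rcases le_total 1 (ε + δ) with h | h
  · exact (𝒳.dist_le_one 𝒵).trans h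
  · have hε₀ : 0 < ε := by positivity
    have hδ₀ : 0 < δ := by positivity
    obtain ⟨hXY, hYX⟩ := close_and_close_of_dist_lt hT (le_self_add.trans h)
      (lt_add_of_pos_right (𝒳.dist 𝒴) (half_pos hη))
    obtain ⟨hYZ, hZY⟩ := close_and_close_of_dist_lt hT (le_add_self.trans h)
      (lt_add_of_pos_right (𝒴.dist 𝒵) (half_pos hη))
    refine dist_le_of_close (by positivity) h (hXY.triangle hT hε₀ hδ₀ h hYZ) ?_
    rw [add_comm]
    exact hZY.triangle hT hδ₀ hε₀ (by rwa [add_comm]) hYX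

/-- The distance on `𝒞'` as a pseudometric. -/
noncomputable abbrev CPrime.pseudoMetricSpace (hT : T.BallSubsetProperty) :
    PseudoMetricSpace (CPrime T) where
  dist x y := CPrime.dist T x y
  dist_self := Quotient.ind fun 𝒳 => NNReal.coe_eq_zero.2 𝒳.dist_self
  dist_comm := Quotient.ind₂ fun 𝒳 𝒴 => NNReal.coe_inj.2 (𝒳.dist_comm 𝒴)
  dist_triangle x y z := Quotient.inductionOn₃ x y z fun 𝒳 𝒴 𝒵 =>
    NNReal.coe_le_coe.2 (Tuple.dist_triangle hT 𝒳 𝒴 𝒵)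

end Metric

section Completeness

theorem cauchyComplete_nndist (C : Type*) [PseudoMetricSpace C] [CompleteSpace C] :
    CauchyComplete (nndist : C → C → ℝ≥0) := by
  intro x hx
  obtain ⟨y, hy⟩ := cauchySeq_tendsto_of_complete <| Metric.cauchySeq_iff.2 fun ε hε =>
    hx ⟨ε, hε.le⟩ hε
  exact ⟨y, fun ε hε => Metric.tendsto_atTop.1 hy ε hε⟩

theorem exists_seq_of_forall_exists {α : Type*} {P : ℕ → α → Prop} {Q : ℕ → α → α → Prop}
    (h₀ : ∃ a, P 0 a) (h : ∀ m a, P m a → ∃ b, P (m + 1) b ∧ Q m a b) :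
    ∃ a : ℕ → α, ∀ m, P m (a m) ∧ Q m (a m) (a (m + 1)) := by
  obtain ⟨a, ha⟩ := h₀
  choose! next hP hQ using h
  let s : ℕ → α := fun m => Nat.rec a next m
  have hs (m : ℕ) : P m (s m) := by
    induction m with
    | zero => exact ha
    | succ m ih => exact hP m _ ih
  exact ⟨s, fun m => ⟨hs m, hQ m _ (hs m)⟩⟩

variable {τ : PosFunctor.{u, v}} {T : Truncation τ}

theorem IsSandwiched.exists_isSandwich_of_isSandwiched {𝒳 : Tuple T} {A B : CompactTuple τ}
    {r s : ℝ≥0} (hA : IsSandwiched r A 𝒳) (hAs : ∀ x, dist x A.origin ≤ s)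
    (hB : IsSandwiched s B 𝒳) : ∃ f, IsSandwich r A B f := by
  obtain ⟨R, hsR, g, hg⟩ := hB
  obtain ⟨f, hf⟩ := hA.exists_isSandwich fun x => (hAs x).trans (NNReal.coe_le_coe.2 hsR)
  obtain ⟨l, hl, hgl⟩ := hg.exists_lift A f hf.1 fun x => by
    rw [hf.dist_map_origin]
    exact hAs x
  exact ⟨l, hf.inner_of_comp hg.1 hl hgl⟩

theorem exists_seq_isSandwiched (hT : T.BallSubsetProperty) {Z : ℕ → Tuple T} {r : ℝ≥0}
    {η : ℕ → ℝ≥0} (hη : ∀ m, η m = 2 * η (m + 1)) (hr : ∀ m, r + 2 ≤ (η m)⁻¹)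
    (hZ : ∀ m, Close (η m) (Z m) (Z (m + 1))) :
    ∃ A : ℕ → CompactTuple τ, ∀ m, IsSandwiched r (A m) (Z m) ∧
      (∀ x, dist x (A m).origin ≤ (r + 2 : ℝ≥0)) ∧ dc (A m) (A (m + 1)) < (η m : ℝ≥0∞) / 2 := by
  have hη_le (m : ℕ) : 2 * η m ≤ 1 :=
    (mul_le_mul_left (le_add_self.trans (hr m)) (η m)).trans inv_mul_le_one
  let P (m : ℕ) (A : CompactTuple τ) : Prop :=
    IsSandwiched (r + 2 * η m) A (Z m) ∧ ∀ x, dist x A.origin ≤ r + 2 - 2 * η m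
  have hP_zero : P 0 ((Z 0).compactBall (r + 1)) := by
    refine ⟨(IsSandwiched.compactBall _ _).mono (add_le_add le_rfl (hη_le 0)), fun x =>
      (dist_origin_le_of_compactBall _ _ x).trans ?_⟩
    have hη₀ := NNReal.coe_le_coe.2 (hη_le 0)
    push_cast at hη₀ ⊢
    linarith
  have hP_le {m : ℕ} {A : CompactTuple τ} (hA : P m A) (x : A.carrier) :
      dist x A.origin ≤ (r + 2 : ℝ≥0) :=
    (hA.2 x).trans (sub_le_self _ (by positivity))
  have hP_succ (m : ℕ) (A : CompactTuple τ) (hA : P m A) :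
      ∃ A', P (m + 1) A' ∧ dc A A' < (η m : ℝ≥0∞) / 2 := by
    have hs : r + η m + η m = r + 2 * η m := by rw [two_mul, add_assoc]
    have hs' : r + 2 * η m ≤ (η m)⁻¹ :=
      (add_le_add le_rfl ((hη_le m).trans one_le_two)).trans (hr m)
    obtain ⟨A', hA', hd⟩ := (hZ m).exists_isSandwiched hT hA.1
      (fun x => (hP_le hA x).trans (NNReal.coe_le_coe.2 (hr m))) hs.le (hs.trans_le hs')
    refine ⟨A', ⟨by rwa [← hη], fun x => ?_⟩, hd⟩
    have hx := dist_origin_le_of_dc_lt hd hA.2 x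
    have hηm := congrArg NNReal.toReal (hη m)
    push_cast at hηm
    linarith
  obtain ⟨A, hA⟩ := exists_seq_of_forall_exists ⟨_, hP_zero⟩ hP_succ
  exact ⟨A, fun m => ⟨(hA m).1.1.mono le_self_add, hP_le (hA m).1, (hA m).2⟩⟩

theorem exists_tendsto_dc (hτ : τ.HausdorffContinuous)
    (hcomplete : ∀ (X : Type u) [MetricSpace X] [CompactSpace X], CompleteSpace (τ.obj X))
    {A : ℕ → CompactTuple τ} (hA : ∀ m, dc (A m) (A (m + 1)) < 2⁻¹ ^ m) :
    ∃ B, Tendsto (fun m => dc (A m) B) atTop (𝓝 0) := by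
  obtain ⟨L, _, _, b, hb⟩ := (hτ.pointed.imageClosed (MetricFunctor.completeSpace_pointed
    hcomplete)).exists_tendsto_ghf (MetricFunctor.completeSpace_pointed hcomplete)
      (fun m => ((A m).origin, (A m).str)) hA
  exact ⟨⟨L, b.1, b.2⟩, hb⟩

theorem exists_approximations (hT : T.BallSubsetProperty) (hτ : τ.HausdorffContinuous)
    (hcomplete : ∀ (X : Type u) [MetricSpace X] [CompactSpace X], CompleteSpace (τ.obj X))
    {Y : ℕ → Tuple T} (hY : ∀ n, Close (2 ^ (n + 3))⁻¹ (Y n) (Y (n + 1))) (k : ℕ) :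
    ∃ (A : ℕ → CompactTuple τ) (B : CompactTuple τ), (∀ m, IsSandwiched (2 * k + 2) (A m)
      (Y (k + m)) ∧ ∀ x, dist x (A m).origin ≤ (2 * (k + 1 : ℕ) + 2 : ℝ≥0)) ∧
      Tendsto (fun m => dc (A m) B) atTop (𝓝 0) := by
  let η (m : ℕ) : ℝ≥0 := (2 ^ (k + m + 3))⁻¹
  have hη (m : ℕ) : η m = 2 * η (m + 1) := by
    simp only [η]
    rw [← add_assoc k, add_right_comm (k + m), pow_succ _ (k + m + 3), mul_inv_rev,
      mul_inv_cancel_left₀ two_ne_zero]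
  have hη_inv (m : ℕ) : 2 * k + 2 + 2 ≤ (η m)⁻¹ := by
    have hk : k + 1 ≤ 2 ^ k := Nat.lt_two_pow_self
    have h : 2 * k + 2 + 2 ≤ 2 ^ (k + m + 3) :=
      calc 2 * k + 2 + 2
        _ ≤ 2 ^ (k + 3) := by rw [pow_add]; omega
        _ ≤ 2 ^ (k + m + 3) := Nat.pow_le_pow_right two_pos (by omega)
    rw [inv_inv]
    exact_mod_cast h
  have hη_le (m : ℕ) : (η m : ℝ≥0∞) / 2 ≤ 2⁻¹ ^ m := by
    refine ENNReal.half_le_self.trans ?_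
    rw [← ENNReal.inv_pow, ENNReal.coe_inv (by positivity), ENNReal.coe_pow, ENNReal.coe_ofNat,
      ENNReal.inv_le_inv]
    exact pow_le_pow_right₀ one_le_two (by omega)
  obtain ⟨A, hA⟩ := exists_seq_isSandwiched hT hη hη_inv fun m => hY (k + m)
  obtain ⟨B, hB⟩ := exists_tendsto_dc hτ hcomplete fun m => (hA m).2.2.trans_le (hη_le m)
  refine ⟨A, B, fun m => ⟨(hA m).1, fun x => ((hA m).2.1 x).trans_eq ?_⟩, hB⟩
  push_cast
  ring

theorem exists_tendsto_dist (hT : T.BallSubsetProperty) (hτ : τ.PointwiseContinuous)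
    (hτ' : τ.HausdorffContinuous)
    (hcomplete : ∀ (X : Type u) [MetricSpace X] [CompactSpace X], CompleteSpace (τ.obj X))
    {Y : ℕ → Tuple T} (hY : ∀ n, Close (2 ^ (n + 3))⁻¹ (Y n) (Y (n + 1))) :
    ∃ 𝒳 : Tuple T, Tendsto (fun n => (Y n).dist 𝒳) atTop (𝓝 0) := by
  choose A B hA hB using exists_approximations hT hτ' hcomplete hY
  have hlim (k : ℕ) : ∃ f, IsSandwich (2 * k) (B k) (B (k + 1)) f := by
    refine exists_isSandwich_of_forall_dc_lt hT hτ (lt_add_of_pos_right _ two_pos) fun c hc => ?_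
    obtain ⟨m, hm, hm'⟩ := ((((hB k).comp (tendsto_add_atTop_nat 1)).eventually_lt_const hc).and
      ((hB (k + 1)).eventually_lt_const hc)).exists
    obtain ⟨hA₁, hAr⟩ := hA k (m + 1)
    have hA₂ := (hA (k + 1) m).1
    rw [add_assoc, add_comm 1 m] at hA₂
    obtain ⟨f, hf⟩ := hA₁.exists_isSandwich_of_isSandwiched hAr hA₂
    exact ⟨_, _, f, hf, hm, hm'⟩
  choose f hf using hlim
  have hρ : Monotone fun k : ℕ => (2 * k : ℝ≥0) := fun k m h =>
    mul_le_mul_right (Nat.cast_le.2 h) 2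
  have hρ' : Tendsto (fun k : ℕ => (2 * k : ℝ≥0)) atTop atTop :=
    tendsto_natCast_atTop_atTop.const_mul_atTop two_pos
  obtain ⟨X, _, o, i, h⟩ := exists_isExhaustion hρ hρ' hf
  obtain ⟨𝒳, h𝒳⟩ := h.exists_tuple T
  refine ⟨𝒳, tendsto_order.2 ⟨fun _ h => absurd h not_lt_zero, fun ε hε => ?_⟩⟩
  obtain ⟨δ, hδ, hδε⟩ := exists_between (lt_min hε one_pos)
  obtain ⟨k, hk⟩ := (hρ'.eventually_ge_atTop δ⁻¹).exists
  have hd : ∀ᶠ m in atTop, dc (A k m) (B k) < (δ : ℝ≥0∞) / 2 :=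
    (hB k).eventually_lt_const (ENNReal.half_pos (ENNReal.coe_ne_zero.2 hδ.ne'))
  filter_upwards [(tendsto_sub_atTop_nat k).eventually hd, eventually_ge_atTop k] with n hn hkn
  have hAn := (hA k (n - k)).1
  rw [Nat.add_sub_cancel' hkn] at hAn
  exact (dist_le_of_isSandwiched hT hδ (hδε.le.trans (min_le_right _ _))
    (hAn.mono le_self_add) (h𝒳 k) hn hk).trans_lt (hδε.trans_le (min_le_left _ _))

theorem CPrime.completeSpace (hT : T.BallSubsetProperty) (hτ : τ.PointwiseContinuous)
    (hτ' : τ.HausdorffContinuous)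
    (hcomplete : ∀ (X : Type u) [MetricSpace X] [CompactSpace X], CompleteSpace (τ.obj X)) :
    let := CPrime.pseudoMetricSpace hT
    CompleteSpace (CPrime T) := by
  let := CPrime.pseudoMetricSpace hT
  refine Metric.complete_of_convergent_controlled_sequences (fun n => (2 ^ (n + 3))⁻¹)
    (fun n => by positivity) fun x hx => ?_
  obtain ⟨Y, rfl⟩ : ∃ Y : ℕ → Tuple T, x = fun n => Quotient.mk (tupleSetoid T) (Y n) :=
    ⟨fun n => (x n).out, funext fun n => ((x n).out_eq).symm⟩
  obtain ⟨𝒳, h𝒳⟩ := exists_tendsto_dist hT hτ hτ' hcomplete (Y := Y) fun n =>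
    (close_and_close_of_dist_lt hT (inv_le_one_of_one_le₀ (one_le_pow₀ one_le_two))
      (NNReal.coe_lt_coe.1 (by exact_mod_cast hx n n (n + 1) le_rfl n.le_succ))).1
  exact ⟨Quotient.mk _ 𝒳, tendsto_iff_dist_tendsto_zero.2 (NNReal.tendsto_coe.2 h𝒳)⟩

theorem CPrime.cauchyComplete_dist (hT : T.BallSubsetProperty) (hτ : τ.PointwiseContinuous)
    (hτ' : τ.HausdorffContinuous)
    (hcomplete : ∀ (X : Type u) [MetricSpace X] [CompactSpace X], CompleteSpace (τ.obj X)) :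
    CauchyComplete (CPrime.dist T) := by
  let := CPrime.pseudoMetricSpace hT
  have := CPrime.completeSpace hT hτ hτ' hcomplete
  exact cauchyComplete_nndist (CPrime T)

end Completeness

section Separability

variable {τ : PosFunctor.{u, v}} {T : Truncation τ}

theorem exists_dc_denseCompact_le (hτ : τ.HausdorffContinuous)
    {S : ∀ n, Set (denseCompact.{u} n × τ.obj (denseCompact.{u} n))} (hS : ∀ n, Dense (S n))
    (A : CompactTuple τ) {c : ℝ≥0∞} (hc : 0 < c) :
    ∃ n, ∃ p ∈ S n, dc A ⟨denseCompact.{u} n, p.1, p.2⟩ ≤ c :=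
  hτ.pointed.exists_ghf_denseCompact_le hS (A.origin, A.str) hc

theorem CPrime.countablyDense_dist (hT : T.BallSubsetProperty) (hτ : τ.HausdorffContinuous)
    (hsep : ∀ (X : Type u) [MetricSpace X] [CompactSpace X], SeparableSpace (τ.obj X)) :
    CountablyDense (CPrime.dist T) := by
  have hS (n : ℕ) : ∃ S : Set (denseCompact.{u} n × τ.obj (denseCompact.{u} n)),
      S.Countable ∧ Dense S := by
    have := hsep (denseCompact.{u} n)
    exact exists_countable_dense _
  choose S hSc hSd using hS
  refine ⟨⋃ n, (fun p => Quotient.mk (tupleSetoid T)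
    (CompactTuple.toTuple T ⟨denseCompact.{u} n, p.1, p.2⟩)) '' S n,
    Set.countable_iUnion fun n => (hSc n).image _, fun x ε hε => ?_⟩
  obtain ⟨𝒳, rfl⟩ := Quotient.exists_rep x
  obtain ⟨δ, hδ, hδε⟩ := exists_between (lt_min hε one_pos)
  obtain ⟨hδε, hδ₁⟩ := lt_min_iff.1 hδε
  obtain ⟨c, hc, hcδ⟩ := exists_between (ENNReal.half_pos (ENNReal.coe_pos.2 hδ).ne')
  obtain ⟨n, p, hp, hd⟩ := exists_dc_denseCompact_le hτ hSd (𝒳.compactBall δ⁻¹) hc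
  exact ⟨_, Set.mem_iUnion.2 ⟨n, p, hp, rfl⟩, (dist_le_of_isSandwiched hT hδ hδ₁.le
    (IsSandwiched.compactBall 𝒳 δ⁻¹) (isSandwiched_toTuple_iff.2 ⟨id, .id _ _⟩)
    (lt_of_le_of_lt hd hcδ) le_rfl).trans_lt hδε⟩

end Separability

end GHF

theorem theorem4p7_general (τ : GHF.PosFunctor.{u, v}) (T : GHF.Truncation τ)
    (hball : T.BallSubsetProperty)
    (hpointwise : τ.toMetricFunctor.PointwiseContinuous)
    (hhausdorff : τ.toMetricFunctor.HausdorffContinuous) :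
    ((∀ (X : Type u) [MetricSpace X] [CompactSpace X], CompleteSpace (τ.obj X)) →
        GHF.CauchyComplete (GHF.CPrime.dist T)) ∧
      ((∀ (X : Type u) [MetricSpace X] [CompactSpace X],
          TopologicalSpace.SeparableSpace (τ.obj X)) →
        GHF.CountablyDense (GHF.CPrime.dist T)) :=
  ⟨GHF.CPrime.cauchyComplete_dist hball hpointwise hhausdorff,
    GHF.CPrime.countablyDense_dist hball hhausdorff⟩

theorem theorem4p7 (τ : GHF.PosFunctor.{u, v}) (T : GHF.Truncation τ)
    (hrigid : τ.NoShrinking)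
    (hsub : T.SubsetProperty)
    (hball : T.BallSubsetProperty)
    (himage : τ.toMetricFunctor.ImageClosed)
    (hpointwise : τ.toMetricFunctor.PointwiseContinuous)
    (hhausdorff : τ.toMetricFunctor.HausdorffContinuous) :
    ((∀ (X : Type u) [MetricSpace X] [CompactSpace X], CompleteSpace (τ.obj X)) →
        GHF.CauchyComplete (GHF.CPrime.dist T)) ∧
      ((∀ (X : Type u) [MetricSpace X] [CompactSpace X],
          TopologicalSpace.SeparableSpace (τ.obj X)) →
        GHF.CountablyDense (GHF.CPrime.dist T)) :=
  theorem4p7_general τ T hball hpointwise hhausdorff
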